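/- All graphs are finite, simple and undirected. For a connected graph $G$, let $\varepsilon_G(u)=\max_{v\in V(G)}d_G(u,v)$ be the eccentricity of a vertex $u$, let the diameter of $G$ be $\max_{u\in V(G)}\varepsilon_G(u)$, and let the second Zagreb eccentricity index of $G$ be $$\sigma_2(G)=\sum_{uv\in E(G)}\varepsilon_G(u)\,\varepsilon_G(v).$$ For integers $n>d\ge 3$, let $B_{n,d}$ be the $n$-vertex graph formed from a path with vertices $v_0,v_1,\dots,v_d$ in order by adding $n-d-1$ pairwise adjacent new vertices, each of them also adjacent to $v_0$ and $v_1$ and to no other vertex of the path. Let $B'_{n,d}$ be formed in the same way, with each new vertex adjacent to $v_0$, $v_1$ and $v_2$ and to no other vertex of the path. **Theorem.** Let $n>d\ge 3$ be integers. 1. If $d\le (n+2)/2$, then $B_{n,d}$ is a connected $n$-vertex graph of diameter $d$, and $\sigma_2(G)\le\sigma_2(B_{n,d})$ for every connected $n$-vertex graph $G$ of diameter $d$. 2. If $d\ge (n+3)/2$, then $B'_{n,d}$ is a connected $n$-vertex graph of diameter $d$, and $\sigma_2(G)\le\sigma_2(B'_{n,d})$ for every connected $n$-vertex graph $G$ of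 diameter $d$. -/

import Mathlib

universe u w

/-- The eccentricity `ε_G(u) = max_v d_G(u, v)` as a natural number. The extended eccentricity
`G.eccent u` is finite whenever `G` is a finite connected graph. -/
noncomputable def eccentricity {V : Type*} (G : SimpleGraph V) (u : V) : ℕ :=
  (G.eccent u).toNat

open scoped Classical in
/-- The second Zagreb eccentricity index `σ₂(G) = ∑_{uv ∈ E(G)} ε_G(u) ε_G(v)`. -/
noncomputable def sigmaTwo {V : Type*} [Fintype V] (G : SimpleGraph V) : ℕ :=
  ∑ e ∈ G.edgeFinset,
    Sym2.lift ⟨fun u v => eccentricity G u * eccentricity G v, fun _ _ => Nat.mul_comm _ _⟩ e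

/-- A path with vertices `v₀, …, v_d` (the vertices `Sum.inl i`) together with `n - d - 1`
pairwise adjacent further vertices (the vertices `Sum.inr a`), each of them adjacent to exactly
the path vertices `v_i` with `i < k`. For `d < n` this graph has `n` vertices. -/
def pathWithClique (n d k : ℕ) : SimpleGraph (Fin (d + 1) ⊕ Fin (n - d - 1)) where
  Adj x y :=
    match x, y with
    | Sum.inl i, Sum.inl j => (i : ℕ) + 1 = j ∨ (j : ℕ) + 1 = i
    | Sum.inl i, Sum.inr _ => (i : ℕ) < k
    | Sum.inr _, Sum.inl j => (j : ℕ) < k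
    | Sum.inr a, Sum.inr b => a ≠ b
  symm := ⟨by
    rintro (i | a) (j | b) h
    · exact Or.symm h
    · exact h
    · exact h
    · exact Ne.symm h⟩
  loopless := ⟨by
    rintro (i | a) h
    · rcases h with h | h <;> omega
    · exact h rfl⟩

/-- The graph `B_{n,d}`: the clique vertices are joined to `v₀` and `v₁`. -/
def graphB (n d : ℕ) : SimpleGraph (Fin (d + 1) ⊕ Fin (n - d - 1)) :=
  pathWithClique n d 2

/-- The graph `B'_{n,d}`: the clique vertices are joined to `v₀`, `v₁` and `v₂`. -/
def graphB' (n d : ℕ) : SimpleGraph (Fin (d + 1) ⊕ Fin (n - d - 1)) :=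
  pathWithClique n d 3

/-- `H` maximizes `σ₂` over the (connected) `n`-vertex graphs of diameter `d`: it belongs to this
class, and no graph of the class, on any vertex type of the universe `u`, has a larger value. -/
def MaximizesSigmaTwo {W : Type w} [Fintype W] (n d : ℕ) (H : SimpleGraph W) : Prop :=
  (Fintype.card W = n ∧ H.Connected ∧ H.diam = d) ∧
    ∀ (V : Type u) [Fintype V] (G : SimpleGraph V),
      Fintype.card V = n → G.Connected → G.diam = d → sigmaTwo G ≤ sigmaTwo H

/-!
Let `v 0, …, v d` be a path between two vertices at distance `d`, and let `m = n - d - 1` be the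
number of vertices off the path. A vertex off the path has at most three neighbours on the path,
and these are within distance two of each other. The eccentricity of `v i` is at least
`w_i = max i (d - i)`, its distance to the farther end. There are two cases.

* All path eccentricities are equal to `w_i`. Then a vertex off the path either has at most two
  neighbours on the path, or it has three and (for `d ≥ 4`) an eccentricity of at most `d - 1`,
  because it is adjacent to a vertex near the middle. If all vertices off the path are made
  adjacent, the resulting bound is a convex function of the number of vertices of the second kind.
  Its values at the two extremes are the indices of `graphB` and `graphB'`, and the sign of
  their difference depends on whether `d ≤ m + 3`
  (`IsDiametralPath.exists_two_mul_sigmaTwo_le_of_four_le`). For `d = 3` a vertex with three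
  neighbours on the path and eccentricity three has two non-neighbours off the path
  (`IsDiametralPath.exists_two_nonadj_of_card_eq_three`), which is enough.

* Some vertex `x` has a distance larger than `w_i` to some `v i`. Then the index is at most that of
  `graphB` (`IsDiametralPath.two_mul_sigmaTwo_le_of_excess`). Indeed `x` has at most one neighbour
  on the path and is adjacent to no vertex with three neighbours on the path. So, in the count
  of edges, each non-edge at `x` makes up for a third neighbour. A closer look at the vertices all
  of whose edges are as heavy as possible shows that no vertex other than `x` contributes more
  than the average vertex of `graphB` does (`IsDiametralPath.share_le`), while `x` contributes less
  by `d ^ 2 - d`, or more if `x` has no neighbour on the path. These savings pay for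
  the larger eccentricities on the path: if these exceed `w_i` by one and only in one half of the
  path, then the edges of the path gain at most `d ^ 2 - d` (with a small correction for
  `d = 4`); if they do so in both halves, there are two vertices like `x`; and if the excess
  is `k + 2`, there are `k + 2` vertices with at most one neighbour on the path, all but one
  of which have none.
-/

/-! ### Distances, eccentricities and geodesics -/

section Metric

variable {V : Type*} {G : SimpleGraph V}

lemma ediam_ne_top_of_connected [Finite V] (hG : G.Connected) : G.ediam ≠ ⊤ :=
  have := hG.nonempty
  SimpleGraph.connected_iff_ediam_ne_top.1 hG

lemma coe_eccentricity [Finite V] (hG : G.Connected) (u : V) :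
    (eccentricity G u : ℕ∞) = G.eccent u :=
  ENat.natCast_toNat fun h => ediam_ne_top_of_connected hG
    (top_le_iff.1 (h ▸ SimpleGraph.eccent_le_ediam))

lemma dist_le_eccentricity [Finite V] (hG : G.Connected) (u v : V) :
    G.dist u v ≤ eccentricity G u := by
  have h : G.edist u v ≤ G.eccent u := SimpleGraph.edist_le_eccent
  rw [← coe_eccentricity hG, ← (hG u v).coe_dist_eq_edist] at h
  exact_mod_cast h

lemma exists_dist_eq_eccentricity [Finite V] (hG : G.Connected) (u : V) :
    ∃ v, G.dist u v = eccentricity G u := by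
  have := hG.nonempty
  obtain ⟨v, hv⟩ := SimpleGraph.exists_edist_eq_eccent_of_finite (G := G) u
  rw [← coe_eccentricity hG, ← (hG u v).coe_dist_eq_edist] at hv
  exact ⟨v, by exact_mod_cast hv⟩

lemma eccentricity_le [Finite V] (hG : G.Connected) {u : V} {k : ℕ}
    (h : ∀ v, G.dist u v ≤ k) : eccentricity G u ≤ k := by
  obtain ⟨v, hv⟩ := exists_dist_eq_eccentricity hG u
  exact hv ▸ h v

lemma dist_le_add_one_of_adj (hG : G.Connected) {u v : V} (h : G.Adj u v) (x : V) :
    G.dist u x ≤ G.dist v x + 1 := by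
  have := hG.dist_triangle (u := u) (v := v) (w := x)
  rw [SimpleGraph.dist_eq_one_iff_adj.2 h] at this
  omega

lemma dist_le_two_of_adj_adj (hG : G.Connected) {u v x : V} (h : G.Adj u v) (h' : G.Adj u x) :
    G.dist v x ≤ 2 := by
  have := dist_le_add_one_of_adj hG h.symm x
  rw [SimpleGraph.dist_eq_one_iff_adj.2 h'] at this
  omega

/-- `v 0, v 1, …, v d` is a geodesic of `G`. The values of `v` beyond `d` are irrelevant; indexing
by `ℕ` makes the reversed path simply `fun i => v (d - i)`. -/
def IsGeodesic (G : SimpleGraph V) (d : ℕ) (v : ℕ → V) : Prop :=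
  ∀ i j, i ≤ j → j ≤ d → G.dist (v i) (v j) = j - i

lemma exists_isGeodesic (hG : G.Connected) (x y : V) :
    ∃ v : ℕ → V, v 0 = x ∧ v (G.dist x y) = y ∧ IsGeodesic G (G.dist x y) v := by
  obtain ⟨p, hp⟩ := hG.exists_walk_length_eq_dist x y
  have hstep : ∀ i j, i ≤ j → G.dist (p.getVert i) (p.getVert j) ≤ j - i := by
    intro i j hij
    induction j, hij using Nat.le_induction with
    | base => simp
    | succ j hij ih =>
      have h1 := hG.dist_triangle (u := p.getVert i) (v := p.getVert j) (w := p.getVert (j + 1))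
      have h2 : G.dist (p.getVert j) (p.getVert (j + 1)) ≤ 1 := by
        by_cases hj : j < p.length
        · exact (SimpleGraph.dist_eq_one_iff_adj.2 (p.adj_getVert_succ hj)).le
        · rw [p.getVert_of_length_le (by omega), p.getVert_of_length_le (by omega)]
          simp
      omega
  refine ⟨p.getVert, p.getVert_zero, by rw [← hp]; exact p.getVert_length, ?_⟩
  intro i j hij hj
  have h0 := hstep 0 i (by omega)
  have h1 := hstep i j hij
  have h2 := hstep j (G.dist x y) hj
  rw [p.getVert_zero] at h0
  rw [← hp, p.getVert_length, hp] at h2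
  have h3 := hG.dist_triangle (u := x) (v := p.getVert i) (w := y)
  have h4 := hG.dist_triangle (u := p.getVert i) (v := p.getVert j) (w := y)
  omega

namespace IsGeodesic

variable {d : ℕ} {v : ℕ → V}

lemma dist_eq (hv : IsGeodesic G d v) {i j : ℕ} (hi : i ≤ d) (hj : j ≤ d) :
    G.dist (v i) (v j) = (j - i) + (i - j) := by
  rcases le_total i j with h | h
  · rw [hv i j h hj]; omega
  · rw [SimpleGraph.dist_comm, hv j i h hi]; omega

lemma reverse (hv : IsGeodesic G d v) : IsGeodesic G d (fun i => v (d - i)) := by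
  intro i j hij hj
  rw [hv.dist_eq (by omega) (by omega)]
  omega

lemma injOn (hv : IsGeodesic G d v) {i j : ℕ} (hi : i ≤ d) (hj : j ≤ d) (h : v i = v j) :
    i = j := by
  have := hv.dist_eq hi hj
  rw [h, SimpleGraph.dist_self] at this
  omega

lemma adj_iff (hv : IsGeodesic G d v) {i j : ℕ} (hi : i ≤ d) (hj : j ≤ d) :
    G.Adj (v i) (v j) ↔ i + 1 = j ∨ j + 1 = i := by
  rw [← SimpleGraph.dist_eq_one_iff_adj, hv.dist_eq hi hj]
  omega

end IsGeodesic

lemma exists_adj_dist_succ (hG : G.Connected) {x y : V} (hxy : 0 < G.dist x y) :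
    ∃ z, G.Adj x z ∧ G.dist x y = G.dist z y + 1 := by
  obtain ⟨p, h0, h1, hp⟩ := exists_isGeodesic hG x y
  refine ⟨p 1, ?_, ?_⟩
  · rw [← h0]
    exact (hp.adj_iff (by omega) (by omega)).2 (Or.inl rfl)
  · have := hp 1 _ (by omega) le_rfl
    rw [h1] at this
    omega

end Metric

/-! ### The index as a sum over ordered pairs of vertices -/

open scoped Classical in
/-- The contribution `ε(u) ε(v)` of the pair `u, v` to the index, which is `0` unless `u` and `v`
are adjacent. -/
noncomputable def pairWeight {V : Type*} (G : SimpleGraph V) (u v : V) : ℕ :=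
  if G.Adj u v then eccentricity G u * eccentricity G v else 0

lemma pairWeight_comm {V : Type*} (G : SimpleGraph V) (u v : V) :
    pairWeight G u v = pairWeight G v u := by
  classical
  unfold pairWeight
  rw [Nat.mul_comm]
  exact if_congr (G.adj_comm u v) rfl rfl

open scoped Classical in
lemma two_mul_sigmaTwo {V : Type*} [Fintype V] (G : SimpleGraph V) :
    2 * sigmaTwo G = ∑ u, ∑ v, pairWeight G u v := by
  set f : Sym2 V → ℕ := Sym2.lift ⟨fun u v => eccentricity G u * eccentricity G v,
    fun _ _ => Nat.mul_comm _ _⟩ with hf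
  have h1 : ∑ a : G.Dart, f a.edge = 2 * sigmaTwo G := by
    rw [← Finset.sum_fiberwise_of_maps_to (s := Finset.univ) (t := G.edgeFinset)
      (g := fun a : G.Dart => a.edge) (fun a _ => by simp), sigmaTwo,
      Finset.mul_sum]
    refine Finset.sum_congr rfl fun e he => ?_
    rw [Finset.sum_congr rfl (g := fun _ => f e) (fun a ha => by
      rw [(Finset.mem_filter.1 ha).2]), Finset.sum_const,
      G.dart_edge_fiber_card e (by simpa using he), smul_eq_mul]
  have h2 : ∑ u, ∑ v, pairWeight G u v =
      ∑ p ∈ (Finset.univ : Finset (V × V)) with G.Adj p.1 p.2,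
        eccentricity G p.1 * eccentricity G p.2 := by
    rw [Finset.sum_filter, ← Finset.univ_product_univ, Finset.sum_product]
    rfl
  rw [← h1, h2]
  refine Finset.sum_bij (fun a _ => (a.fst, a.snd)) (fun a _ => by simp)
    (fun a _ b _ h => ?_) (fun p hp => ⟨⟨p, (Finset.mem_filter.1 hp).2⟩, by simp⟩)
    (fun a _ => ?_)
  · exact SimpleGraph.Dart.ext _ _ h
  · rfl

lemma sum_range_consecutive (f : ℕ → ℕ) (d : ℕ) :
    (∑ i ∈ Finset.range (d + 1), ∑ j ∈ Finset.range (d + 1),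
      if i + 1 = j ∨ j + 1 = i then f i * f j else 0) =
    2 * ∑ i ∈ Finset.range d, f i * f (i + 1) := by
  have h : ∀ i j, (if i + 1 = j ∨ j + 1 = i then f i * f j else 0) =
      (if i + 1 = j then f i * f j else 0) + (if j + 1 = i then f j * f i else 0) := by
    intro i j
    by_cases h1 : i + 1 = j
    · have h2 : ¬ j + 1 = i := by omega
      simp [h1, h2]
    · simp [h1, Nat.mul_comm]
  have h2 : (∑ i ∈ Finset.range (d + 1), ∑ j ∈ Finset.range (d + 1),
      if i + 1 = j then f i * f j else 0) = ∑ i ∈ Finset.range d, f i * f (i + 1) := by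
    rw [Finset.sum_range_succ]
    have h3 : (∑ j ∈ Finset.range (d + 1), if d + 1 = j then f d * f j else 0) = 0 :=
      Finset.sum_eq_zero fun j hj => if_neg (by simp at hj; omega)
    rw [h3, add_zero]
    refine Finset.sum_congr rfl fun i hi => ?_
    rw [Finset.sum_ite_eq, if_pos (by simp at hi ⊢; omega)]
  simp only [h, Finset.sum_add_distrib]
  rw [h2, Finset.sum_comm (f := fun i j => if j + 1 = i then f j * f i else 0), h2]
  ring

section Decomposition

variable {V : Type*} {G : SimpleGraph V} {d : ℕ} {v : ℕ → V}

open scoped Classical in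
/-- The vertices that do not lie on the path `v 0, …, v d`. -/
noncomputable def offPath [Fintype V] (d : ℕ) (v : ℕ → V) : Finset V :=
  Finset.univ.filter fun u => ∀ i ≤ d, u ≠ v i

open scoped Classical in
/-- The indices of the path vertices adjacent to `u`. -/
noncomputable def pathNbrs (G : SimpleGraph V) (d : ℕ) (v : ℕ → V) (u : V) : Finset ℕ :=
  (Finset.range (d + 1)).filter fun i => G.Adj u (v i)

/-- The contribution to the index of the edges between `u` and the path. -/
noncomputable def crossWeight (G : SimpleGraph V) (d : ℕ) (v : ℕ → V) (u : V) : ℕ :=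
  ∑ i ∈ pathNbrs G d v u, eccentricity G u * eccentricity G (v i)

/-- The contribution to the index of the edges of the path. -/
noncomputable def pathWeight (G : SimpleGraph V) (d : ℕ) (v : ℕ → V) : ℕ :=
  ∑ i ∈ Finset.range d, eccentricity G (v i) * eccentricity G (v (i + 1))

lemma mem_offPath [Fintype V] {u : V} : u ∈ offPath d v ↔ ∀ i ≤ d, u ≠ v i := by
  classical
  simp [offPath]

lemma mem_pathNbrs {u : V} {i : ℕ} : i ∈ pathNbrs G d v u ↔ i ≤ d ∧ G.Adj u (v i) := by
  classical
  simp [pathNbrs]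

lemma IsGeodesic.sum_eq [Fintype V] (hv : IsGeodesic G d v) (f : V → ℕ) :
    ∑ u, f u = (∑ i ∈ Finset.range (d + 1), f (v i)) + ∑ u ∈ offPath d v, f u := by
  classical
  have himg : ∑ i ∈ Finset.range (d + 1), f (v i) =
      ∑ u ∈ (Finset.range (d + 1)).image v, f u := by
    rw [Finset.sum_image]
    intro i hi j hj h
    simp only [Finset.coe_range, Set.mem_Iio] at hi hj
    exact hv.injOn (by omega) (by omega) h
  have hcompl : offPath d v = ((Finset.range (d + 1)).image v)ᶜ := by
    ext u
    simp only [mem_offPath, Finset.mem_compl, Finset.mem_image, Finset.mem_range, not_exists,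
      not_and, Nat.lt_succ_iff, ne_eq]
    exact forall₂_congr fun i _ => not_congr eq_comm
  rw [himg, hcompl, Finset.sum_add_sum_compl]

lemma IsGeodesic.card_offPath [Fintype V] (hv : IsGeodesic G d v) :
    Fintype.card V = d + 1 + (offPath d v).card := by
  have := hv.sum_eq (fun _ => 1)
  simpa using this

lemma sum_pairWeight_path (u : V) :
    ∑ i ∈ Finset.range (d + 1), pairWeight G u (v i) = crossWeight G d v u := by
  classical
  rw [crossWeight, pathNbrs, Finset.sum_filter]
  rfl

lemma IsGeodesic.two_mul_sigmaTwo [Fintype V] (hv : IsGeodesic G d v) :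
    2 * sigmaTwo G = 2 * pathWeight G d v + 2 * ∑ u ∈ offPath d v, crossWeight G d v u +
      ∑ u ∈ offPath d v, ∑ x ∈ offPath d v, pairWeight G u x := by
  classical
  rw [_root_.two_mul_sigmaTwo, hv.sum_eq]
  simp only [hv.sum_eq (fun x => pairWeight G _ x), Finset.sum_add_distrib, sum_pairWeight_path]
  have h1 : ∑ i ∈ Finset.range (d + 1), crossWeight G d v (v i) = 2 * pathWeight G d v := by
    rw [pathWeight, ← sum_range_consecutive (fun i => eccentricity G (v i))]
    refine Finset.sum_congr rfl fun i hi => ?_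
    rw [← sum_pairWeight_path]
    refine Finset.sum_congr rfl fun j hj => ?_
    simp only [Finset.mem_range] at hi hj
    simp only [pairWeight, hv.adj_iff (show i ≤ d by omega) (show j ≤ d by omega)]
  have h2 : ∑ i ∈ Finset.range (d + 1), ∑ x ∈ offPath d v, pairWeight G (v i) x =
      ∑ x ∈ offPath d v, crossWeight G d v x := by
    rw [Finset.sum_comm]
    refine Finset.sum_congr rfl fun x _ => ?_
    rw [← sum_pairWeight_path]
    exact Finset.sum_congr rfl fun i _ => pairWeight_comm _ _ _
  rw [h1, h2]
  ring

end Decomposition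

/-! ### Neighbours on a diametral path -/

/-- `v 0, …, v d` is a geodesic of the connected graph `G`, and no two vertices of `G` are at
distance more than `d ≥ 3`. -/
structure IsDiametralPath {V : Type*} (G : SimpleGraph V) (d : ℕ) (v : ℕ → V) : Prop where
  connected : G.Connected
  three_le : 3 ≤ d
  dist_le : ∀ x y, G.dist x y ≤ d
  isGeodesic : IsGeodesic G d v

namespace IsDiametralPath

variable {V : Type*} {G : SimpleGraph V} {d : ℕ} {v : ℕ → V}

lemma reverse (h : IsDiametralPath G d v) : IsDiametralPath G d (fun i => v (d - i)) :=
  ⟨h.connected, h.three_le, h.dist_le, h.isGeodesic.reverse⟩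

lemma eccentricity_le [Finite V] (h : IsDiametralPath G d v) (u : V) : eccentricity G u ≤ d :=
  _root_.eccentricity_le h.connected (h.dist_le u)

lemma le_add_two (h : IsDiametralPath G d v) {u : V} {i j : ℕ} (hi : i ∈ pathNbrs G d v u)
    (hj : j ∈ pathNbrs G d v u) : j ≤ i + 2 := by
  rw [mem_pathNbrs] at hi hj
  have := dist_le_two_of_adj_adj h.connected hi.2 hj.2
  rw [h.isGeodesic.dist_eq hi.1 hj.1] at this
  omega

lemma exists_pathNbrs_subset (h : IsDiametralPath G d v) {u : V}
    (hu : (pathNbrs G d v u).Nonempty) :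
    ∃ j ∈ pathNbrs G d v u, pathNbrs G d v u ⊆ {j, j + 1, j + 2} := by
  refine ⟨_, Finset.min'_mem _ hu, fun i hi => ?_⟩
  have h1 := h.le_add_two (Finset.min'_mem _ hu) hi
  have h2 := Finset.min'_le _ i hi
  simp only [Finset.mem_insert, Finset.mem_singleton]
  omega

lemma card_pathNbrs_le (h : IsDiametralPath G d v) (u : V) : (pathNbrs G d v u).card ≤ 3 := by
  rcases (pathNbrs G d v u).eq_empty_or_nonempty with h0 | h0
  · simp [h0]
  · obtain ⟨j, -, hj⟩ := h.exists_pathNbrs_subset h0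
    exact (Finset.card_le_card hj).trans Finset.card_le_three

lemma exists_pathNbrs_eq_of_card_eq_three (h : IsDiametralPath G d v) {u : V}
    (hu : (pathNbrs G d v u).card = 3) :
    ∃ j, j + 2 ≤ d ∧ pathNbrs G d v u = {j, j + 1, j + 2} ∧ G.Adj u (v j) ∧
      G.Adj u (v (j + 1)) ∧ G.Adj u (v (j + 2)) := by
  obtain ⟨j, -, hj⟩ := h.exists_pathNbrs_subset (u := u) (Finset.card_pos.1 (by omega))
  have heq : pathNbrs G d v u = {j, j + 1, j + 2} :=
    Finset.eq_of_subset_of_card_le hj (by rw [hu]; exact Finset.card_le_three)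
  have h0 : j ∈ pathNbrs G d v u := by simp [heq]
  have h1 : j + 1 ∈ pathNbrs G d v u := by simp [heq]
  have h2 : j + 2 ∈ pathNbrs G d v u := by simp [heq]
  rw [mem_pathNbrs] at h0 h1 h2
  exact ⟨j, h2.1, heq, h0.2, h1.2, h2.2⟩

lemma exists_pathNbrs_eq_of_card_eq_two (h : IsDiametralPath G d v) {u : V}
    (hu : (pathNbrs G d v u).card = 2) :
    ∃ i j, i < j ∧ j ≤ i + 2 ∧ j ≤ d ∧ pathNbrs G d v u = {i, j} ∧ G.Adj u (v i) ∧
      G.Adj u (v j) := by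
  obtain ⟨a, b, hab, heq⟩ := Finset.card_eq_two.1 hu
  have ha : a ∈ pathNbrs G d v u := by simp [heq]
  have hb : b ∈ pathNbrs G d v u := by simp [heq]
  have h1 := h.le_add_two ha hb
  have h2 := h.le_add_two hb ha
  rw [mem_pathNbrs] at ha hb
  rcases hab.lt_or_gt with hlt | hlt
  · exact ⟨a, b, hlt, h1, hb.1, heq, ha.2, hb.2⟩
  · exact ⟨b, a, hlt, h2, ha.1, heq.trans (Finset.pair_comm a b), hb.2, ha.2⟩

lemma dist_le_of_mem_pathNbrs (h : IsDiametralPath G d v) {x : V} {a i : ℕ}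
    (ha : a ∈ pathNbrs G d v x) (hi : i ≤ d) :
    G.dist x (v i) ≤ (i - a) + (a - i) + 1 := by
  rw [mem_pathNbrs] at ha
  rw [← h.isGeodesic.dist_eq ha.1 hi]
  exact dist_le_add_one_of_adj h.connected ha.2 _

/-- A vertex with three neighbours on the path is as close to each `v i` as a vertex of the path,
so it has no neighbour that is farther from `v i` than both ends of the path are. -/
lemma not_adj_of_max_lt_dist (h : IsDiametralPath G d v) {x u : V} {i : ℕ} (hi : i ≤ d)
    (hx : max i (d - i) < G.dist x (v i)) (hu : (pathNbrs G d v u).card = 3) :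
    ¬ G.Adj u x := by
  intro hux
  obtain ⟨j, hjd, heq, -, -, -⟩ := h.exists_pathNbrs_eq_of_card_eq_three hu
  have h0 := h.dist_le_of_mem_pathNbrs (x := u) (a := j) (by simp [heq]) hi
  have h1 := h.dist_le_of_mem_pathNbrs (x := u) (a := j + 1) (by simp [heq]) hi
  have h2 := h.dist_le_of_mem_pathNbrs (x := u) (a := j + 2) (by simp [heq]) hi
  have h3 := dist_le_add_one_of_adj h.connected hux.symm (v i)
  have := h.three_le
  omega

lemma pathNbrs_subset_of_max_lt_dist (h : IsDiametralPath G d v) {x : V} {i : ℕ} (hi : i ≤ d)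
    (hx : max i (d - i) < G.dist x (v i)) :
    ∀ a ∈ pathNbrs G d v x, a = 0 ∧ d ≤ 2 * i ∨ a = d ∧ 2 * i ≤ d := by
  intro a ha
  have h1 := h.dist_le_of_mem_pathNbrs ha hi
  rw [mem_pathNbrs] at ha
  omega

lemma card_pathNbrs_le_one_of_max_lt_dist (h : IsDiametralPath G d v) {x : V} {i : ℕ}
    (hi : i ≤ d) (hx : max i (d - i) < G.dist x (v i)) : (pathNbrs G d v x).card ≤ 1 := by
  refine Finset.card_le_one.2 fun a ha b hb => ?_
  have h1 := h.pathNbrs_subset_of_max_lt_dist hi hx a ha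
  have h2 := h.pathNbrs_subset_of_max_lt_dist hi hx b hb
  have h3 := h.le_add_two ha hb
  have h4 := h.le_add_two hb ha
  have := h.three_le
  omega

lemma pathNbrs_eq_empty_of_max_add_one_lt_dist (h : IsDiametralPath G d v) {x : V} {i : ℕ}
    (hi : i ≤ d) (hx : max i (d - i) + 1 < G.dist x (v i)) : pathNbrs G d v x = ∅ := by
  refine Finset.eq_empty_of_forall_notMem fun a ha => ?_
  have h1 := h.dist_le_of_mem_pathNbrs ha hi
  rw [mem_pathNbrs] at ha
  omega

lemma mem_offPath_of_max_lt_dist [Fintype V] (h : IsDiametralPath G d v) {x : V} {i : ℕ}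
    (hi : i ≤ d) (hx : max i (d - i) < G.dist x (v i)) : x ∈ offPath d v := by
  rw [mem_offPath]
  rintro j hj rfl
  rw [h.isGeodesic.dist_eq hj hi] at hx
  omega

/-- Let `z` be at distance `d` from `u`. If all other vertices off the path were adjacent to `u`,
then `z` would only be adjacent to the far end of the path, and the distance from `z` to the near
end would be `d + 1`. -/
lemma exists_two_nonadj_of_card_eq_three [Fintype V] (h : IsDiametralPath G d v) {u : V}
    (hu : (pathNbrs G d v u).card = 3) (he : eccentricity G u = d) :
    ∃ z ∈ offPath d v, ∃ z' ∈ offPath d v, z ≠ z' ∧ z ≠ u ∧ z' ≠ u ∧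
      ¬ G.Adj u z ∧ ¬ G.Adj u z' := by
  have hd := h.three_le
  obtain ⟨j, hjd, heq, hj0, hj1, hj2⟩ := h.exists_pathNbrs_eq_of_card_eq_three hu
  have hpath : ∀ b ≤ d, G.dist u (v b) ≤ d - 1 ∧
      (d - 1 ≤ G.dist u (v b) → b = d ∧ j = 0 ∨ b = 0 ∧ j + 2 = d) := by
    intro b hb
    have h0 := h.dist_le_of_mem_pathNbrs (x := u) (a := j) (by simp [heq]) hb
    have h1 := h.dist_le_of_mem_pathNbrs (x := u) (a := j + 1) (by simp [heq]) hb
    have h2 := h.dist_le_of_mem_pathNbrs (x := u) (a := j + 2) (by simp [heq]) hb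
    omega
  obtain ⟨z, hz⟩ := exists_dist_eq_eccentricity h.connected u
  rw [he] at hz
  have hzW : z ∈ offPath d v := by
    rw [mem_offPath]
    rintro b hb rfl
    have := (hpath b hb).1
    omega
  have hzu : z ≠ u := by
    rintro rfl
    rw [SimpleGraph.dist_self] at hz
    omega
  have hznadj : ¬ G.Adj u z := fun hadj => by
    rw [SimpleGraph.dist_eq_one_iff_adj.2 hadj] at hz
    omega
  by_contra! hcon
  -- every neighbour of `z` is the end of the path that is far from `u`
  have hnbr : ∀ y, G.Adj z y → ∃ b, y = v b ∧ (b = d ∧ j = 0 ∨ b = 0 ∧ j + 2 = d) := by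
    intro y hzy
    have hdist : d - 1 ≤ G.dist u y := by
      have := dist_le_add_one_of_adj h.connected hzy u
      rw [SimpleGraph.dist_comm, hz, SimpleGraph.dist_comm] at this
      omega
    by_cases hy : y ∈ offPath d v
    · have hyu : y ≠ u := by
        rintro rfl
        rw [SimpleGraph.dist_self] at hdist
        omega
      have := hcon z hzW y hy hzy.ne hzu hyu hznadj
      rw [SimpleGraph.dist_eq_one_iff_adj.2 this] at hdist
      omega
    · rw [mem_offPath] at hy
      push Not at hy
      obtain ⟨b, hb, rfl⟩ := hy
      exact ⟨b, rfl, (hpath b hb).2 hdist⟩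
  obtain ⟨c, hc, hcd⟩ : ∃ c ≤ d, (c = 0 ∧ j = 0 ∨ c = d ∧ j + 2 = d) := by
    obtain ⟨y, hy, -⟩ := exists_adj_dist_succ h.connected (x := z) (y := u)
      (by rw [SimpleGraph.dist_comm]; omega)
    obtain ⟨b, -, hb | hb⟩ := hnbr y hy
    · exact ⟨0, by omega, by omega⟩
    · exact ⟨d, le_rfl, by omega⟩
  obtain ⟨y, hy, hdist⟩ := exists_adj_dist_succ h.connected (x := z) (y := v c)
    (h.connected.pos_dist_of_ne (mem_offPath.1 hzW c hc))
  obtain ⟨b, rfl, hb⟩ := hnbr y hy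
  rw [h.isGeodesic.dist_eq (by omega) hc] at hdist
  have := h.dist_le z (v c)
  omega

/-- If `u` is adjacent to everything off the path, then its two neighbours on the path are the
first or the last two path vertices, and the inner one of them has eccentricity at most `d - 1`. -/
lemma exists_eccentricity_lt_of_card_eq_two [Fintype V] (h : IsDiametralPath G d v) {u : V}
    (hu : (pathNbrs G d v u).card = 2) (he : eccentricity G u = d)
    (hadj : ∀ x ∈ offPath d v, x ≠ u → G.Adj u x) :
    ∃ i ∈ pathNbrs G d v u, eccentricity G (v i) < d := by
  have hd := h.three_le
  obtain ⟨i, j, hij, -, hjd, heq, hi, hj⟩ := h.exists_pathNbrs_eq_of_card_eq_two hu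
  obtain ⟨z, hz⟩ := exists_dist_eq_eccentricity h.connected u
  rw [he] at hz
  have hzP : z ∉ offPath d v := fun hzW => by
    have hzu : z ≠ u := by
      rintro rfl
      rw [SimpleGraph.dist_self] at hz
      omega
    rw [SimpleGraph.dist_eq_one_iff_adj.2 (hadj z hzW hzu)] at hz
    omega
  rw [mem_offPath] at hzP
  push Not at hzP
  obtain ⟨b, hb, rfl⟩ := hzP
  have h0 := h.dist_le_of_mem_pathNbrs (x := u) (a := i) (by simp [heq]) hb
  have h1 := h.dist_le_of_mem_pathNbrs (x := u) (a := j) (by simp [heq]) hb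
  have key : ∀ c, 1 ≤ c → c + 1 ≤ d → G.Adj u (v c) → eccentricity G (v c) < d := by
    intro c hc1 hcd hc
    have : eccentricity G (v c) ≤ d - 1 := by
      refine _root_.eccentricity_le h.connected fun y => ?_
      by_cases hy : y ∈ offPath d v
      · by_cases hyu : y = u
        · subst hyu
          rw [SimpleGraph.dist_eq_one_iff_adj.2 hc.symm]
          omega
        · have := dist_le_two_of_adj_adj h.connected hc (hadj y hy hyu)
          omega
      · rw [mem_offPath] at hy
        push Not at hy
        obtain ⟨a, ha, rfl⟩ := hy
        rw [h.isGeodesic.dist_eq (by omega) ha]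
        omega
    omega
  by_cases hi0 : i = 0
  · exact ⟨j, by simp [heq], key j (by omega) (by omega) hj⟩
  · exact ⟨i, by simp [heq], key i (by omega) (by omega) hi⟩

end IsDiametralPath

/-! ### Sums along a path -/

/-- The weight `∑ w_i w_{i+1}` of a path `v 0, …, v d` whose vertices have the least possible
eccentricities `w_i = max i (d - i)`. -/
def minPathWeight (d : ℕ) : ℕ :=
  ∑ i ∈ Finset.range d, max i (d - i) * max (i + 1) (d - (i + 1))

lemma two_mul_sum_max_le (d : ℕ) :
    2 * ∑ i ∈ Finset.range d, (max i (d - i) + max (i + 1) (d - (i + 1))) ≤ 3 * d ^ 2 + 1 := by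
  induction d using Nat.twoStepInduction with
  | zero => simp
  | one => simp
  | more d ih _ =>
    have h : ∑ i ∈ Finset.range d,
        (max (i + 1) (d + 2 - (i + 1)) + max (i + 1 + 1) (d + 2 - (i + 1 + 1))) =
        ∑ i ∈ Finset.range d, (max i (d - i) + max (i + 1) (d - (i + 1)) + 2) := by
      refine Finset.sum_congr rfl fun i hi => ?_
      rw [Finset.mem_range] at hi
      omega
    rw [Finset.sum_range_succ, Finset.sum_range_succ', h, Finset.sum_add_distrib, Finset.sum_const,
      Finset.card_range, smul_eq_mul]
    have h1 : max (d + 1) (d + 2 - (d + 1)) + max (d + 1 + 1) (d + 2 - (d + 1 + 1)) =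
      2 * d + 3 := by omega
    have h2 : max 0 (d + 2 - 0) + max (0 + 1) (d + 2 - (0 + 1)) = 2 * d + 3 := by omega
    rw [h1, h2]
    nlinarith

/-- Only the first and the last edge use the bound `e i ≤ d`: there it is much better than
`e i ≤ w_i + k`. -/
lemma sum_mul_succ_le {d k : ℕ} (hd : 2 ≤ d) {e : ℕ → ℕ} (hed : ∀ i ≤ d, e i ≤ d)
    (he : ∀ i ≤ d, e i ≤ max i (d - i) + k) :
    2 * ∑ i ∈ Finset.range d, e i * e (i + 1) + 8 * k * d + 4 * k ^ 2 ≤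
      2 * minPathWeight d + k * (3 * d ^ 2 + 1) + 4 * d + 4 * k + 2 * k ^ 2 * d := by
  obtain ⟨c, rfl⟩ : ∃ c, d = c + 2 := ⟨d - 2, by omega⟩
  have hf := two_mul_sum_max_le (c + 2)
  have hmid : ∑ i ∈ Finset.range c, e (i + 1) * e (i + 1 + 1) ≤
      ∑ i ∈ Finset.range c,
        (max (i + 1) (c + 2 - (i + 1)) * max (i + 1 + 1) (c + 2 - (i + 1 + 1)) +
        k * (max (i + 1) (c + 2 - (i + 1)) + max (i + 1 + 1) (c + 2 - (i + 1 + 1))) + k ^ 2) := by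
    refine Finset.sum_le_sum fun i hi => ?_
    rw [Finset.mem_range] at hi
    calc _ ≤ _ := Nat.mul_le_mul (he (i + 1) (by omega)) (he (i + 1 + 1) (by omega))
      _ = _ := by ring
  have h0 : e 0 * e (0 + 1) ≤ (c + 2) * (c + 2) :=
    Nat.mul_le_mul (hed _ (by omega)) (hed _ (by omega))
  have h1 : e (c + 1) * e (c + 1 + 1) ≤ (c + 2) * (c + 2) :=
    Nat.mul_le_mul (hed _ (by omega)) (hed _ (by omega))
  rw [Finset.sum_add_distrib, Finset.sum_add_distrib, Finset.sum_const, ← Finset.mul_sum,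
    Finset.card_range, smul_eq_mul] at hmid
  rw [minPathWeight]
  rw [Finset.sum_range_succ, Finset.sum_range_succ'] at hf ⊢
  rw [Finset.sum_range_succ (n := c + 1), Finset.sum_range_succ' (n := c)]
  have a1 : max 0 (c + 2 - 0) = c + 2 := by omega
  have a2 : max (0 + 1) (c + 2 - (0 + 1)) = c + 1 := by omega
  have a3 : max (c + 1) (c + 2 - (c + 1)) = c + 1 := by omega
  have a4 : max (c + 1 + 1) (c + 2 - (c + 1 + 1)) = c + 2 := by omega
  rw [a1, a2, a3, a4] at hf ⊢
  have hk := Nat.mul_le_mul_left k hf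
  nlinarith

lemma mul_add_le_of_le_add {d k p p' q q' : ℕ} (hd : 1 ≤ d) (hp : p ≤ d) (hp' : p' ≤ d)
    (hq : q ≤ p) (hq' : q' ≤ p') (hpq : p ≤ q + k) (hpq' : p' ≤ q' + k) :
    p * p' + k ≤ q * q' + k * (2 * d) := by
  obtain ⟨a, rfl⟩ := Nat.exists_eq_add_of_le hq
  obtain ⟨b, rfl⟩ := Nat.exists_eq_add_of_le hq'
  have ha : a ≤ k := by omega
  have hb : b ≤ k := by omega
  have h1 : (q + a) * b ≤ d * k := Nat.mul_le_mul hp hb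
  rcases Nat.eq_zero_or_pos b with rfl | hb0
  · have h2 : a * q' ≤ k * d := Nat.mul_le_mul ha (by omega)
    nlinarith
  · have h2 : a * (q' + 1) ≤ k * d := Nat.mul_le_mul ha (by omega)
    rcases Nat.eq_zero_or_pos a with rfl | ha0
    · nlinarith
    · have h3 : a * q' ≤ k * (d - 1) := Nat.mul_le_mul ha (by omega)
      obtain ⟨c, rfl⟩ : ∃ c, d = c + 1 := ⟨d - 1, by omega⟩
      rw [Nat.add_sub_cancel] at h3
      nlinarith

lemma sum_mul_succ_le_of_le_add_two {d k : ℕ} (hd : 2 ≤ d) {e : ℕ → ℕ} (hed : ∀ i ≤ d, e i ≤ d)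
    (he : ∀ i ≤ d, e i ≤ max i (d - i) + (k + 2)) :
    2 * ∑ i ∈ Finset.range d, e i * e (i + 1) + 4 * d + 2 * k * d ≤
      2 * minPathWeight d + 6 * d ^ 2 + 4 * k * d ^ 2 := by
  have h1 := sum_mul_succ_le (k := 2) hd (e := fun i => min (e i) (max i (d - i) + 2))
    (fun i hi => (min_le_left _ _).trans (hed i hi)) (fun i _ => min_le_right _ _)
  have h2 : ∑ i ∈ Finset.range d, (e i * e (i + 1) + k) ≤
      ∑ i ∈ Finset.range d, (min (e i) (max i (d - i) + 2) *
        min (e (i + 1)) (max (i + 1) (d - (i + 1)) + 2) + k * (2 * d)) := by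
    refine Finset.sum_le_sum fun i hi => ?_
    rw [Finset.mem_range] at hi
    have h3 := he i (by omega)
    have h4 := he (i + 1) (by omega)
    exact mul_add_le_of_le_add (by omega) (hed i (by omega)) (hed (i + 1) (by omega))
      (min_le_left _ _) (min_le_left _ _) (by omega) (by omega)
  rw [Finset.sum_add_distrib, Finset.sum_add_distrib, Finset.sum_const, Finset.sum_const,
    Finset.card_range, smul_eq_mul, smul_eq_mul] at h2
  nlinarith

lemma sum_two_mul_sub (d k : ℕ) (hk : k ≤ d) :
    (∑ i ∈ Finset.range k, 2 * (d - (i + 1))) + k ^ 2 + k = 2 * d * k := by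
  induction k with
  | zero => simp
  | succ k ih =>
    have h := ih (by omega)
    rw [Finset.sum_range_succ]
    obtain ⟨c, rfl⟩ : ∃ c, d = c + (k + 1) := ⟨d - (k + 1), by omega⟩
    rw [Nat.add_sub_cancel]
    nlinarith

/-- If only the eccentricities in the first half of the path exceed the least possible ones, and
at most by one, then the weight of the path exceeds the least possible one at most by `d ^ 2 - d`,
except that one more unit is needed for `d = 4`. -/
lemma sum_mul_succ_le_of_half {d : ℕ} (hd : 3 ≤ d) {e : ℕ → ℕ}
    (he : ∀ i ≤ d, e i ≤ max i (d - i) + 1) (he0 : e 0 ≤ d)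
    (he' : ∀ i ≤ d, d < 2 * i → e i ≤ max i (d - i)) :
    (∑ i ∈ Finset.range d, e i * e (i + 1)) + d ≤
      minPathWeight d + d ^ 2 + if d = 4 then 1 else 0 := by
  obtain ⟨k, hk⟩ : ∃ k, d / 2 = k + 1 := ⟨d / 2 - 1, by omega⟩
  -- the largest possible excess of the edge from `i` to `i + 1`
  set g : ℕ → ℕ := fun i => if i = 0 then d else if i < k + 1 then 2 * (d - i) else
    if i = k + 1 then k + 2 else 0 with hg
  have hterm : ∑ i ∈ Finset.range d, e i * e (i + 1) ≤
      ∑ i ∈ Finset.range d, (max i (d - i) * max (i + 1) (d - (i + 1)) + g i) := by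
    refine Finset.sum_le_sum fun i hi => ?_
    rw [Finset.mem_range] at hi
    have h1 := he i (by omega)
    have h2 := he (i + 1) (by omega)
    rcases Nat.eq_zero_or_pos i with rfl | hi0
    · calc e 0 * e (0 + 1) ≤ d * (max (0 + 1) (d - (0 + 1)) + 1) := Nat.mul_le_mul he0 h2
        _ = _ := by simp [hg]; ring
    rcases lt_trichotomy i (k + 1) with hlt | heq | hgt
    · have hgi : g i = 2 * (d - i) := by
        simp only [hg]; rw [if_neg (by omega), if_pos hlt]
      rw [hgi]
      have a1 : max i (d - i) = d - i := by omega
      have a2 : max (i + 1) (d - (i + 1)) + 1 = d - i := by omega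
      calc _ ≤ _ := Nat.mul_le_mul h1 h2
        _ = max i (d - i) * max (i + 1) (d - (i + 1)) + max i (d - i) +
          (max (i + 1) (d - (i + 1)) + 1) := by ring
        _ ≤ _ := by rw [a2]; omega
    · have hgi : g i = i + 1 := by
        simp only [hg]; rw [if_neg (by omega), if_neg (by omega), if_pos heq, heq]
      have h3 := he' (i + 1) (by omega) (by omega)
      have a2 : max (i + 1) (d - (i + 1)) = i + 1 := by omega
      rw [hgi]
      calc _ ≤ _ := Nat.mul_le_mul h1 h3
        _ = _ := by rw [a2]; ring
    · have h3 := he' (i + 1) (by omega) (by omega)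
      have h4 := he' i (by omega) (by omega)
      exact (Nat.mul_le_mul h4 h3).trans (Nat.le_add_right _ _)
  have hsum : ∑ i ∈ Finset.range d, g i =
      (∑ i ∈ Finset.range k, 2 * (d - (i + 1))) + d + (k + 2) := by
    rw [← Finset.sum_subset (Finset.range_subset_range.2 (show k + 2 ≤ d by omega))
      (fun i _ hi => ?_), Finset.sum_range_succ, Finset.sum_range_succ']
    · have h1 : g (k + 1) = k + 2 := by simp [hg]
      have h2 : g 0 = d := by simp [hg]
      rw [h1, h2]
      congr 2
      refine Finset.sum_congr rfl fun i hi => ?_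
      rw [Finset.mem_range] at hi
      simp only [hg]
      rw [if_neg (by omega), if_pos (by omega)]
    · simp only [Finset.mem_range] at hi
      simp only [hg]
      rw [if_neg (by omega), if_neg (by omega), if_neg (by omega)]
  rw [Finset.sum_add_distrib, hsum] at hterm
  have hs := sum_two_mul_sub d k (by omega)
  rw [minPathWeight]
  have hlast : 2 * d * k + 2 * d + (k + 2) ≤
      d ^ 2 + (if d = 4 then 1 else 0) + k ^ 2 + k := by
    rcases Nat.even_or_odd' d with ⟨c, rfl | rfl⟩
    · obtain rfl : c = k + 1 := by omega
      split_ifs with h4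
      · obtain rfl : k = 1 := by omega
        norm_num
      · have : 2 ≤ k := by omega
        nlinarith
    · obtain rfl : c = k + 1 := by omega
      rw [if_neg (by omega)]
      nlinarith
  omega

/-! ### Paths with a vertex whose eccentricity is not attained on the path -/

section Neighbours

variable {V : Type*} {G : SimpleGraph V}

open scoped Classical in
/-- The neighbours of `u` in a finite set `S` of vertices. -/
noncomputable def nbrsIn (G : SimpleGraph V) (S : Finset V) (u : V) : Finset V :=
  S.filter (G.Adj u)

lemma card_nbrsIn_add_one_le {S : Finset V} {u : V} (hu : u ∈ S) :
    (nbrsIn G S u).card + 1 ≤ S.card := by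
  classical
  have : nbrsIn G S u ⊆ S.erase u := fun x hx => by
    rw [nbrsIn, Finset.mem_filter] at hx
    exact Finset.mem_erase.2 ⟨hx.2.ne', hx.1⟩
  have := Finset.card_le_card this
  have := Finset.card_erase_add_one hu
  omega

lemma card_nbrsIn_add_two_le {S : Finset V} {u z : V} (hu : u ∈ S) (hz : z ∈ S) (hzu : z ≠ u)
    (h : ¬ G.Adj u z) : (nbrsIn G S u).card + 2 ≤ S.card := by
  classical
  have h1 : nbrsIn G S u ⊆ nbrsIn G (S.erase z) u := fun x hx => by
    rw [nbrsIn, Finset.mem_filter] at hx ⊢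
    refine ⟨Finset.mem_erase.2 ⟨?_, hx.1⟩, hx.2⟩
    rintro rfl
    exact h hx.2
  have h2 := Finset.card_le_card h1
  have h3 := card_nbrsIn_add_one_le (G := G) (Finset.mem_erase.2 ⟨hzu.symm, hu⟩)
  have := Finset.card_erase_add_one hz
  omega

end Neighbours

lemma mul_add_le_sq {a b d : ℕ} (h : a < d ∧ b ≤ d ∨ a ≤ d ∧ b < d) : a * b + d ≤ d ^ 2 := by
  rcases h with ⟨h1, h2⟩ | ⟨h1, h2⟩ <;> nlinarith

namespace IsDiametralPath

variable {V : Type*} {G : SimpleGraph V} {d : ℕ} {v : ℕ → V}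

lemma sum_pairWeight_le [Finite V] (h : IsDiametralPath G d v) (S : Finset V) (u : V) :
    ∑ x ∈ S, pairWeight G u x ≤ d ^ 2 * (nbrsIn G S u).card := by
  classical
  calc ∑ x ∈ S, pairWeight G u x = ∑ x ∈ nbrsIn G S u, eccentricity G u * eccentricity G x := by
        rw [nbrsIn, Finset.sum_filter]; rfl
    _ ≤ ∑ _x ∈ nbrsIn G S u, d ^ 2 := Finset.sum_le_sum fun x _ => by
        rw [pow_two]
        exact Nat.mul_le_mul (h.eccentricity_le u) (h.eccentricity_le x)
    _ = _ := by rw [Finset.sum_const, smul_eq_mul, Nat.mul_comm]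

lemma crossWeight_le [Finite V] (h : IsDiametralPath G d v) (u : V) :
    crossWeight G d v u ≤ (pathNbrs G d v u).card * d ^ 2 := by
  calc crossWeight G d v u ≤ ∑ _i ∈ pathNbrs G d v u, d ^ 2 := Finset.sum_le_sum fun i _ => by
        rw [pow_two]
        exact Nat.mul_le_mul (h.eccentricity_le u) (h.eccentricity_le (v i))
    _ = _ := by rw [Finset.sum_const, smul_eq_mul]

lemma crossWeight_add_le_of_eccentricity_lt [Finite V] (h : IsDiametralPath G d v) {u : V}
    (hu : eccentricity G u < d) :
    crossWeight G d v u + (pathNbrs G d v u).card * d ≤ (pathNbrs G d v u).card * d ^ 2 := by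
  calc crossWeight G d v u + (pathNbrs G d v u).card * d =
      ∑ i ∈ pathNbrs G d v u, (eccentricity G u * eccentricity G (v i) + d) := by
        rw [Finset.sum_add_distrib, Finset.sum_const, smul_eq_mul, crossWeight]
    _ ≤ ∑ _i ∈ pathNbrs G d v u, d ^ 2 := Finset.sum_le_sum fun i _ =>
        mul_add_le_sq (Or.inl ⟨hu, h.eccentricity_le _⟩)
    _ = _ := by rw [Finset.sum_const, smul_eq_mul]

lemma crossWeight_add_le_of_mem_pathNbrs [Finite V] (h : IsDiametralPath G d v) {u : V} {i : ℕ}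
    (hi : i ∈ pathNbrs G d v u) (hei : eccentricity G (v i) < d) :
    crossWeight G d v u + d ≤ (pathNbrs G d v u).card * d ^ 2 := by
  classical
  have h1 : ∑ j ∈ (pathNbrs G d v u).erase i, eccentricity G u * eccentricity G (v j) ≤
      ∑ _j ∈ (pathNbrs G d v u).erase i, d ^ 2 := Finset.sum_le_sum fun j _ => by
    rw [pow_two]
    exact Nat.mul_le_mul (h.eccentricity_le u) (h.eccentricity_le (v j))
  rw [crossWeight, ← Finset.add_sum_erase _ _ hi]
  rw [Finset.sum_const, smul_eq_mul] at h1
  have h2 := mul_add_le_sq (Or.inr ⟨h.eccentricity_le u, hei⟩)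
  rw [← Finset.card_erase_add_one hi]
  nlinarith

open scoped Classical in
/-- The share of `u` in an upper bound for twice the index: twice the weight of the edges to the
path and of the edge to the distinguished vertex `x`, and once the weight of the edges to the
other vertices off the path, which share such an edge with `u`. All eccentricities off the path
are bounded by `d`. -/
noncomputable def share [Fintype V] (G : SimpleGraph V) (d : ℕ) (v : ℕ → V) (x u : V) : ℕ :=
  2 * crossWeight G d v u + 2 * (d ^ 2 * if G.Adj u x then 1 else 0) +
    d ^ 2 * (nbrsIn G ((offPath d v).erase x) u).card

open scoped Classical in
lemma two_mul_sigmaTwo_le_sum_share [Fintype V] (h : IsDiametralPath G d v) {x : V}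
    (hx : x ∈ offPath d v) :
    2 * sigmaTwo G ≤ 2 * pathWeight G d v + 2 * crossWeight G d v x +
      ∑ u ∈ (offPath d v).erase x, share G d v x u := by
  set S := (offPath d v).erase x with hS
  have hsplit : ∀ f : V → ℕ, ∑ u ∈ offPath d v, f u = f x + ∑ u ∈ S, f u := fun f =>
    (Finset.add_sum_erase _ f hx).symm
  have h1 : ∀ u, pairWeight G u x ≤ d ^ 2 * if G.Adj u x then 1 else 0 := by
    intro u
    rw [pairWeight]
    split_ifs
    · rw [mul_one, pow_two]
      exact Nat.mul_le_mul (h.eccentricity_le u) (h.eccentricity_le x)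
    · simp
  have h2 : pairWeight G x x = 0 := by simp [pairWeight]
  have h3 : ∑ u ∈ S, pairWeight G x u = ∑ u ∈ S, pairWeight G u x :=
    Finset.sum_congr rfl fun u _ => pairWeight_comm _ _ _
  have h4 := Finset.sum_le_sum fun u (_ : u ∈ S) => h1 u
  have h5 := Finset.sum_le_sum fun u (_ : u ∈ S) => h.sum_pairWeight_le S u
  rw [h.isGeodesic.two_mul_sigmaTwo, hsplit]
  simp only [hsplit (fun y => pairWeight G _ y), hsplit (fun u => pairWeight G u x +
    ∑ y ∈ S, pairWeight G u y), h2, h3, Finset.sum_add_distrib, share, ← Finset.mul_sum, ← hS]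
    at h4 h5 ⊢
  omega

section Share

variable [Fintype V] {x u : V} [DecidableEq V]

lemma card_nbrsIn_erase_add_two_le (hx : x ∈ offPath d v) (hu : u ∈ (offPath d v).erase x) :
    (nbrsIn G ((offPath d v).erase x) u).card + 2 ≤ (offPath d v).card := by
  have h1 := card_nbrsIn_add_one_le (G := G) hu
  have h2 := Finset.card_erase_add_one hx
  omega

lemma card_nbrsIn_erase_add_three_le (hx : x ∈ offPath d v) (hu : u ∈ (offPath d v).erase x)
    {z : V} (hz : z ∈ (offPath d v).erase x) (hzu : z ≠ u) (h : ¬ G.Adj u z) :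
    (nbrsIn G ((offPath d v).erase x) u).card + 3 ≤ (offPath d v).card := by
  have h1 := card_nbrsIn_add_two_le hu hz hzu h
  have h2 := Finset.card_erase_add_one hx
  omega

end Share

open scoped Classical in
lemma share_eq [Fintype V] (x u : V) : share G d v x u =
    2 * crossWeight G d v u + 2 * (d ^ 2 * if G.Adj u x then 1 else 0) +
    d ^ 2 * (nbrsIn G ((offPath d v).erase x) u).card := rfl

open scoped Classical in
lemma share_add_le [Fintype V] (h : IsDiametralPath G d v) {x u : V} (hx : x ∈ offPath d v)
    (hu : u ∈ (offPath d v).erase x) :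
    share G d v x u + 4 * d ^ 2 ≤
      2 * ((pathNbrs G d v u).card * d ^ 2) + d ^ 2 * ((offPath d v).card + 4) := by
  have h1 := Nat.mul_le_mul_left (d ^ 2) (card_nbrsIn_erase_add_two_le (G := G) hx hu)
  have h2 := h.crossWeight_le u
  have h3 : d ^ 2 * (if G.Adj u x then 1 else 0) ≤ d ^ 2 := by split_ifs <;> simp
  rw [share_eq]
  linarith

open scoped Classical in
/-- The average share of a vertex in the extremal graph is `d ^ 2 * (m + 4) - 2 * d`, where `m` is
the number of vertices off the path. If `u` has two neighbours on the path and larger share, then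
all edges at `u` are as heavy as possible, so `u` has a non-neighbour off the path. If `u` has
three neighbours on the path, then `x` is such a non-neighbour, and if necessary there is a
second one. -/
lemma share_le [Fintype V] (h : IsDiametralPath G d v) {x u : V} {i : ℕ} (hi : i ≤ d)
    (hxi : max i (d - i) < G.dist x (v i)) (hu : u ∈ (offPath d v).erase x) :
    share G d v x u + 2 * d ≤ d ^ 2 * ((offPath d v).card + 4) := by
  have hx := h.mem_offPath_of_max_lt_dist hi hxi
  have hd := h.three_le
  have hdd : 3 * d ≤ d ^ 2 := by nlinarith
  obtain ⟨hux, huW⟩ := Finset.mem_erase.1 hu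
  have hgen := h.share_add_le hx hu
  have hdeg := Nat.mul_le_mul_left (d ^ 2) (card_nbrsIn_erase_add_two_le (G := G) hx hu)
  have hcross := h.crossWeight_le u
  have hcard := h.card_pathNbrs_le u
  have hadjx : d ^ 2 * (if G.Adj u x then 1 else 0) ≤ d ^ 2 := by split_ifs <;> simp
  rcases (show (pathNbrs G d v u).card ≤ 1 ∨ (pathNbrs G d v u).card = 2 ∨
    (pathNbrs G d v u).card = 3 by omega) with h1 | h2 | h3
  · have := Nat.mul_le_mul_right (d ^ 2) h1
    linarith
  · by_cases hlow : crossWeight G d v u + d ≤ 2 * d ^ 2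
    · rw [share_eq]
      linarith
    · have hue : eccentricity G u = d := by
        by_contra hne
        have := h.crossWeight_add_le_of_eccentricity_lt
          (lt_of_le_of_ne (h.eccentricity_le u) hne)
        rw [h2] at this
        omega
      have hex : ∃ z ∈ offPath d v, z ≠ u ∧ ¬ G.Adj u z := by
        by_contra! hcon
        obtain ⟨j, hj, hej⟩ := h.exists_eccentricity_lt_of_card_eq_two h2 hue hcon
        have := h.crossWeight_add_le_of_mem_pathNbrs hj hej
        rw [h2] at this
        omega
      obtain ⟨z, hz, hzu, hadj⟩ := hex
      rw [h2] at hcross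
      rw [share_eq]
      by_cases hzx : z = x
      · subst hzx
        rw [if_neg hadj]
        linarith
      · have := Nat.mul_le_mul_left (d ^ 2) (card_nbrsIn_erase_add_three_le hx hu
          (Finset.mem_erase.2 ⟨hzx, hz⟩) hzu hadj)
        linarith
  · have hadj := h.not_adj_of_max_lt_dist hi hxi h3
    rw [share_eq, if_neg hadj]
    by_cases hlow : crossWeight G d v u + d ≤ 3 * d ^ 2
    · linarith
    · have hue : eccentricity G u = d := by
        by_contra hne
        have := h.crossWeight_add_le_of_eccentricity_lt
          (lt_of_le_of_ne (h.eccentricity_le u) hne)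
        rw [h3] at this
        omega
      obtain ⟨z, hz, z', hz', hzz, hzu, hzu', hnz, hnz'⟩ :=
        h.exists_two_nonadj_of_card_eq_three h3 hue
      have : (nbrsIn G ((offPath d v).erase x) u).card + 3 ≤ (offPath d v).card := by
        by_cases hzx : z = x
        · exact card_nbrsIn_erase_add_three_le hx hu
            (Finset.mem_erase.2 ⟨fun h' => hzz (hzx.trans h'.symm), hz'⟩) hzu' hnz'
        · exact card_nbrsIn_erase_add_three_le hx hu (Finset.mem_erase.2 ⟨hzx, hz⟩) hzu hnz
      have := Nat.mul_le_mul_left (d ^ 2) this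
      rw [h3] at hcross
      linarith

open scoped Classical in
/-- If the vertices `u ≠ x` off the path stay below the average share of the extremal graph by
`saving u`, then these savings and those at `x` may be spent on the edges of the path. -/
lemma two_mul_sigmaTwo_le_of_saving [Fintype V] (h : IsDiametralPath G d v) {x : V}
    (hx : x ∈ offPath d v) (saving : V → ℕ)
    (hs : ∀ u ∈ (offPath d v).erase x,
      share G d v x u + 2 * d + saving u ≤ d ^ 2 * ((offPath d v).card + 4))
    (hpath : 2 * pathWeight G d v + 2 * crossWeight G d v x + 2 * d ≤
      2 * minPathWeight d + 4 * d ^ 2 + ∑ u ∈ (offPath d v).erase x, saving u) :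
    2 * sigmaTwo G + 2 * (offPath d v).card * d ≤ 2 * minPathWeight d +
      d ^ 2 * ((offPath d v).card ^ 2 + 3 * (offPath d v).card) := by
  have h1 := h.two_mul_sigmaTwo_le_sum_share hx
  have h2 := Finset.sum_le_sum hs
  have hcard := Finset.card_erase_add_one hx
  rw [Finset.sum_add_distrib, Finset.sum_add_distrib, Finset.sum_const, Finset.sum_const,
    smul_eq_mul, smul_eq_mul] at h2
  rw [← hcard] at h2 ⊢
  nlinarith

/-- The case that some vertex `v i` of the path has an eccentricity which exceeds its distances to
both ends by at least two. For the largest such excess `k + 2`, the last `k + 2` vertices of a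
geodesic from `v i` to a farthest vertex lie off the path; the first of them has at most one
neighbour on the path, the other ones have none. -/
lemma two_mul_sigmaTwo_le_of_large_excess [Fintype V] (h : IsDiametralPath G d v)
    (hex : ∃ i ≤ d, max i (d - i) + 2 ≤ eccentricity G (v i)) :
    2 * sigmaTwo G + 2 * (offPath d v).card * d ≤ 2 * minPathWeight d +
      d ^ 2 * ((offPath d v).card ^ 2 + 3 * (offPath d v).card) := by
  classical
  have hd := h.three_le
  have hdd : 3 * d ≤ d ^ 2 := by nlinarith
  obtain ⟨i, hi, hmax⟩ := Finset.exists_max_image (Finset.range (d + 1))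
    (fun i => eccentricity G (v i) - max i (d - i)) ⟨0, by simp⟩
  rw [Finset.mem_range, Nat.lt_succ_iff] at hi
  obtain ⟨k, hk⟩ : ∃ k, eccentricity G (v i) = max i (d - i) + (k + 2) := by
    obtain ⟨j, hj, hej⟩ := hex
    have := hmax j (by simpa [Nat.lt_succ_iff] using hj)
    exact ⟨eccentricity G (v i) - max i (d - i) - 2, by omega⟩
  have hle : ∀ j ≤ d, eccentricity G (v j) ≤ max j (d - j) + (k + 2) := by
    intro j hj
    have := hmax j (by simpa [Nat.lt_succ_iff] using hj)
    omega
  obtain ⟨x, hx⟩ := exists_dist_eq_eccentricity h.connected (v i)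
  obtain ⟨z, hz0, hzx, hz⟩ := exists_isGeodesic h.connected (v i) x
  rw [hx, hk] at hz hzx
  have hdist : ∀ t ≤ max i (d - i) + (k + 2), G.dist (z t) (v i) = t := by
    intro t ht
    rw [← hz0, hz.dist_eq ht (by omega)]
    omega
  rw [hk, SimpleGraph.dist_comm] at hx
  have hxW := h.mem_offPath_of_max_lt_dist (x := x) hi (by omega)
  have hxc : crossWeight G d v x = 0 := by
    rw [crossWeight, h.pathNbrs_eq_empty_of_max_add_one_lt_dist hi (by omega), Finset.sum_empty]
  -- the saving of a vertex with no neighbour, at most one neighbour or more neighbours on the path,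
  -- as a function of its distance `t` to `v i`
  set s : ℕ → ℕ := fun t => if max i (d - i) + 2 ≤ t then 4 * d ^ 2 - 2 * d else
    if max i (d - i) + 1 ≤ t then 2 * d ^ 2 - 2 * d else 0 with hs
  refine h.two_mul_sigmaTwo_le_of_saving hxW (fun u => s (G.dist u (v i))) (fun u hu => ?_) ?_
  · have hgen := h.share_add_le hxW hu
    simp only [hs]
    split_ifs with h1 h2
    · rw [h.pathNbrs_eq_empty_of_max_add_one_lt_dist hi (by omega), Finset.card_empty] at hgen
      omega
    · have := Nat.mul_le_mul_right (d ^ 2)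
        (h.card_pathNbrs_le_one_of_max_lt_dist (x := u) hi (by omega))
      omega
    · exact h.share_le hi (by omega) hu
  · have hinj : Set.InjOn (fun t => z (max i (d - i) + 1 + t)) (Finset.range (k + 1)) := by
      intro a ha b hb hab
      simp only [Finset.coe_range, Set.mem_Iio] at ha hb
      have := hz.injOn (by omega) (by omega) hab
      omega
    have hsub : (Finset.range (k + 1)).image (fun t => z (max i (d - i) + 1 + t)) ⊆
        (offPath d v).erase x := by
      intro u hu
      obtain ⟨t, ht, rfl⟩ := Finset.mem_image.1 hu
      rw [Finset.mem_range] at ht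
      refine Finset.mem_erase.2 ⟨fun heq => ?_, ?_⟩
      · rw [← hzx] at heq
        have := hz.injOn (by omega) (by omega) heq
        omega
      · exact h.mem_offPath_of_max_lt_dist hi (by rw [hdist _ (by omega)]; omega)
    have hsum : k * (4 * d ^ 2 - 2 * d) + (2 * d ^ 2 - 2 * d) ≤
        ∑ u ∈ (offPath d v).erase x, s (G.dist u (v i)) := by
      refine le_trans (le_of_eq ?_) (Finset.sum_le_sum_of_subset hsub)
      rw [Finset.sum_image hinj, Finset.sum_range_succ']
      congr 1
      · rw [Finset.sum_congr rfl (g := fun _ => 4 * d ^ 2 - 2 * d) (fun t ht => ?_),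
          Finset.sum_const, Finset.card_range, smul_eq_mul]
        rw [Finset.mem_range] at ht
        rw [hdist _ (by omega)]
        simp only [hs]
        rw [if_pos (by omega)]
      · rw [hdist _ (by omega)]
        simp [hs]
    have hnum := sum_mul_succ_le_of_le_add_two (d := d) (k := k) (by omega)
      (fun i _ => h.eccentricity_le (v i)) hle
    rw [hxc]
    change 2 * pathWeight G d v + 4 * d + 2 * k * d ≤ _ at hnum
    rw [Nat.mul_sub] at hsum
    have h1 : k * (2 * d) ≤ k * (4 * d ^ 2) := Nat.mul_le_mul_left k (by omega)
    have h2 : k * (2 * d) = 2 * k * d := by ring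
    have h3 : k * (4 * d ^ 2) = 4 * k * d ^ 2 := by ring
    omega

/-- If the eccentricities exceed the least possible ones at most by one, but do so in both halves
of the path, then there are two vertices with at most one neighbour on the path, or one with
none. -/
lemma two_mul_sigmaTwo_le_of_two_sided [Fintype V] (h : IsDiametralPath G d v)
    (hle : ∀ i ≤ d, eccentricity G (v i) ≤ max i (d - i) + 1) {i j : ℕ} (hi : 2 * i < d)
    (hj : j ≤ d) (hdj : d < 2 * j) (hei : max i (d - i) < eccentricity G (v i))
    (hej : max j (d - j) < eccentricity G (v j)) :
    2 * sigmaTwo G + 2 * (offPath d v).card * d ≤ 2 * minPathWeight d +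
      d ^ 2 * ((offPath d v).card ^ 2 + 3 * (offPath d v).card) := by
  classical
  have hd := h.three_le
  have hdd : 3 * d ≤ d ^ 2 := by nlinarith
  obtain ⟨x, hx⟩ := exists_dist_eq_eccentricity h.connected (v i)
  obtain ⟨y, hy⟩ := exists_dist_eq_eccentricity h.connected (v j)
  rw [← hx, SimpleGraph.dist_comm] at hei
  rw [← hy, SimpleGraph.dist_comm] at hej
  have hxW := h.mem_offPath_of_max_lt_dist (by omega) hei
  have hyW := h.mem_offPath_of_max_lt_dist hj hej
  have hnum := sum_mul_succ_le (d := d) (k := 1) (by omega)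
    (fun i _ => h.eccentricity_le (v i)) hle
  change 2 * pathWeight G d v + 8 * 1 * d + 4 * 1 ^ 2 ≤ _ at hnum
  by_cases hxy : x = y
  · subst hxy
    have hxc : crossWeight G d v x = 0 := by
      rw [crossWeight, Finset.eq_empty_of_forall_notMem (s := pathNbrs G d v x) (fun a ha => ?_),
        Finset.sum_empty]
      have h1 := h.pathNbrs_subset_of_max_lt_dist (by omega) hei a ha
      have h2 := h.pathNbrs_subset_of_max_lt_dist hj hej a ha
      omega
    refine h.two_mul_sigmaTwo_le_of_saving hxW (fun _ => 0)
      (fun u hu => h.share_le (by omega) hei hu) ?_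
    rw [hxc, Finset.sum_const_zero]
    omega
  · have hyE : y ∈ (offPath d v).erase x := Finset.mem_erase.2 ⟨Ne.symm hxy, hyW⟩
    refine h.two_mul_sigmaTwo_le_of_saving hxW (fun u => if u = y then 2 * d ^ 2 - 2 * d else 0)
      (fun u hu => ?_) ?_
    · split_ifs with huy
      · subst huy
        have h1 := Nat.mul_le_mul_right (d ^ 2) (h.card_pathNbrs_le_one_of_max_lt_dist hj hej)
        have h2 := h.share_add_le hxW hyE
        omega
      · exact h.share_le (by omega) hei hu
    · have h1 := Nat.mul_le_mul_right (d ^ 2)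
        (h.card_pathNbrs_le_one_of_max_lt_dist (x := x) (by omega) hei)
      have h2 := h.crossWeight_le x
      rw [Finset.sum_ite_eq' _ y, if_pos hyE]
      omega

open scoped Classical in
/-- In diameter four, the neighbour `y` of `x` on a geodesic from `x` to `v 0` stays below the
average share by the unit that the general estimate lacks. -/
lemma exists_share_add_two_le [Fintype V] (h : IsDiametralPath G 4 v) {x : V}
    (hx : G.dist x (v 1) = 4) (he3 : eccentricity G (v 3) ≤ 3) :
    ∃ y ∈ (offPath 4 v).erase x,
      share G 4 v x y + 2 * 4 + 2 ≤ 4 ^ 2 * ((offPath 4 v).card + 4) := by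
  have hxW := h.mem_offPath_of_max_lt_dist (x := x) (i := 1) (by omega) (by omega)
  have hxN := h.pathNbrs_subset_of_max_lt_dist (x := x) (i := 1) (by omega) (by omega)
  obtain ⟨y, hxy, hy⟩ := exists_adj_dist_succ h.connected (x := x) (y := v 0)
    (h.connected.pos_dist_of_ne (mem_offPath.1 hxW 0 (by omega)))
  have hy0 : G.dist y (v 0) ≤ 3 := by
    have := h.dist_le x (v 0)
    omega
  have hy1 : 3 ≤ G.dist y (v 1) := by
    have := dist_le_add_one_of_adj h.connected hxy (v 1)
    omega
  have hyW : y ∈ offPath 4 v := by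
    rw [mem_offPath]
    rintro b hb rfl
    have := hxN b (mem_pathNbrs.2 ⟨hb, hxy⟩)
    rw [h.isGeodesic.dist_eq hb (by omega)] at hy0
    omega
  have hyE : y ∈ (offPath 4 v).erase x := Finset.mem_erase.2 ⟨hxy.ne', hyW⟩
  refine ⟨y, hyE, ?_⟩
  have hyN : pathNbrs G 4 v y ⊆ {3, 4} := by
    intro a ha
    have h1 := h.dist_le_of_mem_pathNbrs (i := 1) ha (by omega)
    rw [mem_pathNbrs] at ha
    simp only [Finset.mem_insert, Finset.mem_singleton]
    omega
  have hgen := h.share_add_le hxW hyE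
  have hcard : (pathNbrs G 4 v y).card ≤ 2 := (Finset.card_le_card hyN).trans Finset.card_le_two
  by_cases h2 : (pathNbrs G 4 v y).card = 2
  · have heq : pathNbrs G 4 v y = {3, 4} :=
      Finset.eq_of_subset_of_card_le hyN (by rw [h2]; exact Finset.card_le_two)
    have hcross : crossWeight G 4 v y ≤ eccentricity G y * 7 := by
      have h4 := h.eccentricity_le (v 4)
      rw [crossWeight, heq, Finset.sum_pair (by norm_num), ← Nat.mul_add]
      exact Nat.mul_le_mul_left _ (by omega)
    have hdeg := card_nbrsIn_erase_add_two_le (G := G) hxW hyE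
    have hadj : (if G.Adj y x then 1 else 0) ≤ 1 := by split_ifs <;> simp
    rw [share_eq]
    have hye := h.eccentricity_le y
    by_cases hye4 : eccentricity G y = 4
    -- otherwise `v 0` is the only vertex that can be at distance four from `y`
    · have hex : ∃ z ∈ (offPath 4 v).erase x, z ≠ y ∧ ¬ G.Adj y z := by
        by_contra! hcon
        obtain ⟨z, hz⟩ := exists_dist_eq_eccentricity h.connected y
        by_cases hzW : z ∈ offPath 4 v
        · have hzy : z ≠ y := by
            rintro rfl
            rw [SimpleGraph.dist_self] at hz
            omega
          have : G.Adj y z := by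
            by_cases hzx : z = x
            · exact hzx ▸ hxy.symm
            · exact hcon z (Finset.mem_erase.2 ⟨hzx, hzW⟩) hzy
          rw [SimpleGraph.dist_eq_one_iff_adj.2 this] at hz
          omega
        · rw [mem_offPath] at hzW
          push Not at hzW
          obtain ⟨b, hb, rfl⟩ := hzW
          have h3 := h.dist_le_of_mem_pathNbrs (x := y) (a := 3) (by simp [heq]) hb
          have hb0 : b = 0 := by omega
          subst hb0
          omega
      obtain ⟨z, hz, hzy, hnz⟩ := hex
      have := card_nbrsIn_erase_add_three_le hxW hyE hz hzy hnz
      omega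
    · omega
  · omega

/-- If the eccentricities exceed the least possible ones at most by one, and only in the first half
of the path, then one vertex with at most one neighbour on the path is enough, except in
diameter four. -/
lemma two_mul_sigmaTwo_le_of_one_sided [Fintype V] (h : IsDiametralPath G d v)
    (hle : ∀ i ≤ d, eccentricity G (v i) ≤ max i (d - i) + 1)
    (hhalf : ∀ i ≤ d, d < 2 * i → eccentricity G (v i) ≤ max i (d - i))
    (hex : ∃ i ≤ d, max i (d - i) < eccentricity G (v i)) :
    2 * sigmaTwo G + 2 * (offPath d v).card * d ≤ 2 * minPathWeight d +
      d ^ 2 * ((offPath d v).card ^ 2 + 3 * (offPath d v).card) := by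
  classical
  have hd := h.three_le
  have hnum := sum_mul_succ_le_of_half hd hle (h.eccentricity_le (v 0)) hhalf
  change pathWeight G d v + d ≤ _ at hnum
  have hgen : ∀ x i, i ≤ d → max i (d - i) < G.dist x (v i) →
      crossWeight G d v x ≤ d ^ 2 := by
    intro x i hi hxi
    have h1 := Nat.mul_le_mul_right (d ^ 2)
      (h.card_pathNbrs_le_one_of_max_lt_dist (x := x) hi hxi)
    have h2 := h.crossWeight_le x
    omega
  by_cases h41 : d = 4 ∧ 4 ≤ eccentricity G (v 1)
  · obtain ⟨rfl, he1⟩ := h41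
    obtain ⟨x, hx⟩ := exists_dist_eq_eccentricity h.connected (v 1)
    rw [SimpleGraph.dist_comm] at hx
    have hx4 : G.dist x (v 1) = 4 := le_antisymm (h.dist_le _ _) (hx ▸ he1)
    have hxi : max 1 (4 - 1) < G.dist x (v 1) := by omega
    have hxW := h.mem_offPath_of_max_lt_dist (i := 1) (by omega) hxi
    have h3 := hhalf 3 (by omega) (by omega)
    obtain ⟨y, hy, hyshare⟩ := h.exists_share_add_two_le hx4 (by omega)
    refine h.two_mul_sigmaTwo_le_of_saving hxW (fun u => if u = y then 2 else 0)
      (fun u hu => ?_) ?_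
    · split_ifs with huy
      · subst huy
        exact hyshare
      · exact h.share_le (by omega) hxi hu
    · have := hgen x 1 (by omega) hxi
      rw [Finset.sum_ite_eq' _ y, if_pos hy]
      rw [if_pos rfl] at hnum
      omega
  · obtain ⟨i, hi, hei⟩ := hex
    obtain ⟨x, hx⟩ := exists_dist_eq_eccentricity h.connected (v i)
    rw [← hx, SimpleGraph.dist_comm] at hei
    have hxW := h.mem_offPath_of_max_lt_dist hi hei
    have hxc := hgen x i hi hei
    refine h.two_mul_sigmaTwo_le_of_saving hxW (fun _ => 0) (fun u hu => h.share_le hi hei hu) ?_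
    rw [Finset.sum_const_zero]
    by_cases hd4 : d = 4
    · subst hd4
      have hmin : minPathWeight 4 = 36 := by decide
      have e0 := h.eccentricity_le (v 0)
      have e1 : eccentricity G (v 1) ≤ 3 := by omega
      have e2 := hle 2 (by omega)
      have e3 := hhalf 3 (by omega) (by omega)
      have e4 := h.eccentricity_le (v 4)
      have hw : pathWeight G 4 v ≤ 42 := by
        simp only [pathWeight, Finset.sum_range_succ, Finset.sum_range_zero, zero_add,
          Nat.reduceAdd]
        have := Nat.mul_le_mul e0 e1
        have := Nat.mul_le_mul e1 e2
        have := Nat.mul_le_mul e2 e3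
        have := Nat.mul_le_mul e3 e4
        norm_num at *
        omega
      omega
    · rw [if_neg hd4] at hnum
      omega

/-- If some eccentricity on the path is not attained at an end of the path, then the index is at
most that of `graphB`. -/
lemma two_mul_sigmaTwo_le_of_excess [Fintype V] (h : IsDiametralPath G d v)
    (hex : ∃ i ≤ d, max i (d - i) < eccentricity G (v i)) :
    2 * sigmaTwo G + 2 * (offPath d v).card * d ≤ 2 * minPathWeight d +
      d ^ 2 * ((offPath d v).card ^ 2 + 3 * (offPath d v).card) := by
  by_cases hlarge : ∃ i ≤ d, max i (d - i) + 2 ≤ eccentricity G (v i)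
  · exact h.two_mul_sigmaTwo_le_of_large_excess hlarge
  have hle : ∀ i ≤ d, eccentricity G (v i) ≤ max i (d - i) + 1 := by
    intro i hi
    by_contra hcon
    exact hlarge ⟨i, hi, by omega⟩
  by_cases hright : ∃ j ≤ d, d < 2 * j ∧ max j (d - j) < eccentricity G (v j)
  · obtain ⟨j, hj, hdj, hej⟩ := hright
    by_cases hleft : ∃ i, 2 * i < d ∧ max i (d - i) < eccentricity G (v i)
    · obtain ⟨i, hi, hei⟩ := hleft
      exact h.two_mul_sigmaTwo_le_of_two_sided hle hi hj hdj hei hej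
    · have hrev := h.reverse.two_mul_sigmaTwo_le_of_one_sided
        (fun i hi => by have := hle (d - i) (by omega); omega)
        (fun i hi hdi => by
          by_contra hcon
          exact hleft ⟨d - i, by omega, by omega⟩)
        ⟨d - j, by omega, by rw [show d - (d - j) = j by omega]; omega⟩
      have h1 := h.isGeodesic.card_offPath
      have h2 := h.reverse.isGeodesic.card_offPath
      rwa [show (offPath d fun i => v (d - i)).card = (offPath d v).card by omega] at hrev
  · refine h.two_mul_sigmaTwo_le_of_one_sided hle (fun i hi hdi => ?_) hex
    by_contra hcon
    exact hright ⟨i, hi, hdi, by omega⟩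

end IsDiametralPath

/-! ### Paths whose eccentricities are attained at their ends -/

namespace IsDiametralPath

variable {V : Type*} {G : SimpleGraph V} {d : ℕ} {v : ℕ → V}

lemma crossWeight_eq_mul_sum (u : V) : crossWeight G d v u =
    eccentricity G u * ∑ i ∈ pathNbrs G d v u, eccentricity G (v i) :=
  (Finset.mul_sum _ _ _).symm

lemma eccentricity_le_add_one_of_adj [Finite V] (hG : G.Connected) {x y : V} (hxy : G.Adj x y) :
    eccentricity G x ≤ eccentricity G y + 1 :=
  _root_.eccentricity_le hG fun z => by
    have h1 := dist_le_add_one_of_adj hG hxy z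
    have h2 := dist_le_eccentricity hG y z
    omega

lemma pathWeight_le_minPathWeight (hend : ∀ i ≤ d, eccentricity G (v i) ≤ max i (d - i)) :
    pathWeight G d v ≤ minPathWeight d :=
  Finset.sum_le_sum fun i hi => by
    rw [Finset.mem_range] at hi
    exact Nat.mul_le_mul (hend i (by omega)) (hend (i + 1) (by omega))

lemma sum_eccentricity_pathNbrs_le_of_card_eq_two (h : IsDiametralPath G d v)
    (hend : ∀ i ≤ d, eccentricity G (v i) ≤ max i (d - i)) {u : V}
    (hu : (pathNbrs G d v u).card = 2) :
    ∑ i ∈ pathNbrs G d v u, eccentricity G (v i) ≤ 2 * d - 1 := by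
  obtain ⟨i, j, hij, hji, hj, heq, -, -⟩ := h.exists_pathNbrs_eq_of_card_eq_two hu
  rw [heq, Finset.sum_pair hij.ne]
  have h1 := hend i (by omega)
  have h2 := hend j hj
  have := h.three_le
  omega

lemma crossWeight_le_of_card_ne_three [Finite V] (h : IsDiametralPath G d v)
    (hend : ∀ i ≤ d, eccentricity G (v i) ≤ max i (d - i)) {u : V}
    (hu : (pathNbrs G d v u).card ≠ 3) : crossWeight G d v u ≤ d * (2 * d - 1) := by
  have hd := h.three_le
  have hcard := h.card_pathNbrs_le u
  by_cases h2 : (pathNbrs G d v u).card = 2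
  · rw [crossWeight_eq_mul_sum]
    exact Nat.mul_le_mul (h.eccentricity_le u)
      (h.sum_eccentricity_pathNbrs_le_of_card_eq_two hend h2)
  · calc crossWeight G d v u ≤ _ := h.crossWeight_le u
      _ ≤ 1 * d ^ 2 := Nat.mul_le_mul_right _ (by omega)
      _ = d * d := by ring
      _ ≤ _ := Nat.mul_le_mul_left _ (by omega)

lemma eccentricity_le_of_card_eq_three [Finite V] (h : IsDiametralPath G d v) (hd : 4 ≤ d)
    (hend : ∀ i ≤ d, eccentricity G (v i) ≤ max i (d - i)) {u : V}
    (hu : (pathNbrs G d v u).card = 3) :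
    eccentricity G u ≤ d - 1 ∧ crossWeight G d v u ≤ 3 * (d - 1) ^ 2 := by
  obtain ⟨j, hj, heq, a0, a1, a2⟩ := h.exists_pathNbrs_eq_of_card_eq_three hu
  have h0 := eccentricity_le_add_one_of_adj h.connected a0
  have h1 := eccentricity_le_add_one_of_adj h.connected a1
  have h2 := eccentricity_le_add_one_of_adj h.connected a2
  have e0 := hend j (by omega)
  have e1 := hend (j + 1) (by omega)
  have e2 := hend (j + 2) (by omega)
  have hle : eccentricity G u ≤ d - 1 := by omega
  refine ⟨hle, ?_⟩
  rw [crossWeight_eq_mul_sum, heq, Finset.sum_insert (by simp), Finset.sum_pair (by omega)]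
  calc _ ≤ (d - 1) * (3 * (d - 1)) := Nat.mul_le_mul hle (by omega)
    _ = _ := by ring

open scoped Classical in
/-- There are two kinds of vertices off the path: `s` with eccentricity at most `d` and at most
two neighbours on the path, and `t` with eccentricity at most `d - 1` and three such neighbours.
The bound is the index of the graph in which all pairs of these vertices are adjacent. -/
lemma exists_two_mul_sigmaTwo_le_of_four_le [Fintype V] (h : IsDiametralPath G d v) (hd : 4 ≤ d)
    (hend : ∀ i ≤ d, eccentricity G (v i) ≤ max i (d - i)) :
    ∃ s t, s + t = (offPath d v).card ∧
      2 * sigmaTwo G + (s * d ^ 2 + t * (d - 1) ^ 2) ≤ 2 * minPathWeight d +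
        2 * (s * (d * (2 * d - 1)) + t * (3 * (d - 1) ^ 2)) + (s * d + t * (d - 1)) ^ 2 := by
  set W := offPath d v with hW
  set p : V → Prop := fun u => (pathNbrs G d v u).card ≠ 3 with hp
  have hsum : ∀ x y : ℕ, ∑ u ∈ W, (if p u then x else y) =
      (W.filter p).card * x + (W.filter fun u => ¬ p u).card * y := by
    intro x y
    rw [Finset.sum_ite, Finset.sum_const, Finset.sum_const, smul_eq_mul, smul_eq_mul]
  refine ⟨(W.filter p).card, (W.filter fun u => ¬ p u).card,
    Finset.card_filter_add_card_filter_not p, ?_⟩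
  have hcross : ∑ u ∈ W, crossWeight G d v u ≤
      ∑ u ∈ W, if p u then d * (2 * d - 1) else 3 * (d - 1) ^ 2 :=
    Finset.sum_le_sum fun u _ => by
      split_ifs with hu
      · exact h.crossWeight_le_of_card_ne_three hend hu
      · exact (h.eccentricity_le_of_card_eq_three hd hend (not_not.1 hu)).2
  set a : V → ℕ := fun u => if p u then d else d - 1 with ha
  have hea : ∀ u, eccentricity G u ≤ a u := by
    intro u
    simp only [ha]
    split_ifs with hu
    · exact h.eccentricity_le u
    · exact (h.eccentricity_le_of_card_eq_three hd hend (not_not.1 hu)).1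
  have hsq : ∀ u, a u ^ 2 = if p u then d ^ 2 else (d - 1) ^ 2 := by
    intro u
    simp only [ha]
    split_ifs <;> rfl
  have hpair : ∑ u ∈ W, ((∑ x ∈ W, pairWeight G u x) + a u ^ 2) ≤
      ∑ u ∈ W, ∑ x ∈ W, a u * a x := by
    refine Finset.sum_le_sum fun u hu => ?_
    rw [← Finset.add_sum_erase _ _ hu, ← Finset.add_sum_erase _ (fun x => a u * a x) hu]
    have h0 : pairWeight G u u = 0 := by simp [pairWeight]
    have h1 : ∑ x ∈ W.erase u, pairWeight G u x ≤ ∑ x ∈ W.erase u, a u * a x :=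
      Finset.sum_le_sum fun x _ => by
        rw [pairWeight]
        split_ifs
        · exact Nat.mul_le_mul (hea u) (hea x)
        · exact Nat.zero_le _
    rw [h0, pow_two]
    omega
  rw [Finset.sum_add_distrib, ← Finset.sum_mul_sum] at hpair
  simp only [hsq] at hpair
  rw [hsum, hsum, ← pow_two] at hpair
  rw [hsum] at hcross
  have hpath := pathWeight_le_minPathWeight hend
  rw [h.isGeodesic.two_mul_sigmaTwo, ← hW]
  omega

open scoped Classical in
lemma two_mul_sigmaTwo_le_of_eq_three [Fintype V] (h : IsDiametralPath G 3 v)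
    (hend : ∀ i ≤ 3, eccentricity G (v i) ≤ max i (3 - i)) :
    2 * sigmaTwo G + 2 * (offPath 3 v).card * 3 ≤ 2 * minPathWeight 3 +
      3 ^ 2 * ((offPath 3 v).card ^ 2 + 3 * (offPath 3 v).card) := by
  have hvertex : ∀ u ∈ offPath 3 v,
      2 * crossWeight G 3 v u + (∑ x ∈ offPath 3 v, pairWeight G u x) + 6 ≤
        9 * ((offPath 3 v).card + 3) := by
    intro u hu
    have hpair := h.sum_pairWeight_le (offPath 3 v) u
    have hdeg := card_nbrsIn_add_one_le (G := G) hu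
    by_cases h3 : (pathNbrs G 3 v u).card = 3
    · obtain ⟨j, hj, heq, a0, a1, a2⟩ := h.exists_pathNbrs_eq_of_card_eq_three h3
      have e0 := hend j (by omega)
      have e1 := hend (j + 1) (by omega)
      have e2 := hend (j + 2) (by omega)
      have hcross : crossWeight G 3 v u ≤ eccentricity G u * 7 := by
        rw [crossWeight_eq_mul_sum, heq, Finset.sum_insert (by simp),
          Finset.sum_pair (by omega)]
        exact Nat.mul_le_mul_left _ (by omega)
      have hue := h.eccentricity_le u
      by_cases hu3 : eccentricity G u = 3
      · obtain ⟨z, hz, z', hz', hzz, hzu, hzu', hnz, hnz'⟩ :=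
          h.exists_two_nonadj_of_card_eq_three h3 hu3
        have := card_nbrsIn_erase_add_three_le hz (Finset.mem_erase.2 ⟨hzu.symm, hu⟩)
          (Finset.mem_erase.2 ⟨hzz.symm, hz'⟩) hzu' hnz'
        have hsub : nbrsIn G (offPath 3 v) u ⊆ nbrsIn G ((offPath 3 v).erase z) u := by
          intro y hy
          rw [nbrsIn, Finset.mem_filter] at hy ⊢
          refine ⟨Finset.mem_erase.2 ⟨?_, hy.1⟩, hy.2⟩
          rintro rfl
          exact hnz hy.2
        have := Finset.card_le_card hsub
        omega
      · omega
    · have := h.crossWeight_le_of_card_ne_three hend h3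
      omega
  have hsum := Finset.sum_le_sum hvertex
  rw [Finset.sum_add_distrib, Finset.sum_add_distrib, ← Finset.mul_sum, Finset.sum_const,
    Finset.sum_const, smul_eq_mul, smul_eq_mul] at hsum
  have hpath := pathWeight_le_minPathWeight hend
  rw [h.isGeodesic.two_mul_sigmaTwo]
  nlinarith

/-- The bound for the index is convex in the number of vertices with three neighbours on the path,
so that it is largest if there are none (`graphB`) or only such vertices (`graphB'`); the first
value is the larger one for `d ≤ m + 3`. -/
lemma two_mul_sigmaTwo_le_of_le [Fintype V] (h : IsDiametralPath G d v)
    (hdm : d ≤ (offPath d v).card + 3) :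
    2 * sigmaTwo G + 2 * (offPath d v).card * d ≤ 2 * minPathWeight d +
      d ^ 2 * ((offPath d v).card ^ 2 + 3 * (offPath d v).card) := by
  by_cases hex : ∃ i ≤ d, max i (d - i) < eccentricity G (v i)
  · exact h.two_mul_sigmaTwo_le_of_excess hex
  push Not at hex
  rcases h.three_le.eq_or_lt with rfl | hd
  · exact h.two_mul_sigmaTwo_le_of_eq_three hex
  obtain ⟨s, t, hst, hσ⟩ := h.exists_two_mul_sigmaTwo_le_of_four_le hd hex
  rw [← hst] at hdm ⊢
  obtain ⟨c, rfl⟩ : ∃ c, d = c + 1 := ⟨d - 1, by omega⟩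
  rw [show 2 * (c + 1) - 1 = 2 * c + 1 by omega, Nat.add_sub_cancel] at hσ
  zify at hσ hdm hd ⊢
  have hs : (0 : ℤ) ≤ s := by positivity
  have ht : (0 : ℤ) ≤ t := by positivity
  -- the claim for `s, t` differs from the one for `s + t, 0`, an equality, by this product
  have h1 : (0 : ℤ) ≤ t * ((s + t + 3 - (c + 1)) * (2 * c + 1) + s + c - 1) := by
    have : (0 : ℤ) ≤ (s + t + 3 - (c + 1)) * (2 * c + 1) :=
      mul_nonneg (by linarith) (by linarith)
    exact mul_nonneg ht (by linarith)
  nlinarith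

/-- For `m + 4 ≤ d` the largest value of the convex bound is that of `graphB'`. -/
lemma two_mul_sigmaTwo_le_of_add_four_le [Fintype V] (h : IsDiametralPath G d v)
    (hdm : (offPath d v).card + 4 ≤ d) :
    2 * sigmaTwo G ≤ 2 * minPathWeight d +
      (d - 1) ^ 2 * ((offPath d v).card ^ 2 + 5 * (offPath d v).card) := by
  by_cases hex : ∃ i ≤ d, max i (d - i) < eccentricity G (v i)
  · have hσ := h.two_mul_sigmaTwo_le_of_excess hex
    set m := (offPath d v).card
    obtain ⟨c, rfl⟩ : ∃ c, d = c + 1 := ⟨d - 1, by omega⟩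
    rw [Nat.add_sub_cancel]
    zify at hσ hdm ⊢
    have hm : (0 : ℤ) ≤ m := by positivity
    -- twice the difference of the indices of `graphB'` and `graphB`
    have h1 : (0 : ℤ) ≤ m * ((c - 3 - m) * (2 * c + 1) + c + 2) := by
      have : (0 : ℤ) ≤ (c - 3 - m) * (2 * c + 1) := mul_nonneg (by linarith) (by linarith)
      exact mul_nonneg hm (by linarith)
    nlinarith
  push Not at hex
  obtain ⟨s, t, hst, hσ⟩ := h.exists_two_mul_sigmaTwo_le_of_four_le (by omega) hex
  rw [← hst] at hdm ⊢
  obtain ⟨c, rfl⟩ : ∃ c, d = c + 1 := ⟨d - 1, by omega⟩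
  rw [show 2 * (c + 1) - 1 = 2 * c + 1 by omega, Nat.add_sub_cancel] at hσ
  rw [Nat.add_sub_cancel]
  zify at hσ hdm ⊢
  have hs : (0 : ℤ) ≤ s := by positivity
  have ht : (0 : ℤ) ≤ t := by positivity
  -- the claim for `s, t` differs from the one for `0, s + t`, an equality, by this product
  have h1 : (0 : ℤ) ≤ s * ((c - 3 - s - t) * (2 * c + 1) + t + c + 2) := by
    have : (0 : ℤ) ≤ (c - 3 - s - t) * (2 * c + 1) := mul_nonneg (by linarith) (by linarith)
    exact mul_nonneg hs (by linarith)
  nlinarith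

end IsDiametralPath

lemma exists_isDiametralPath {V : Type*} [Finite V] {G : SimpleGraph V} {d : ℕ}
    (hG : G.Connected) (hd : 3 ≤ d) (hdiam : G.diam = d) : ∃ v, IsDiametralPath G d v := by
  have := hG.nonempty
  obtain ⟨x, y, hxy⟩ := SimpleGraph.exists_dist_eq_diam (G := G)
  obtain ⟨v, -, -, hv⟩ := exists_isGeodesic hG x y
  rw [hxy, hdiam] at hv
  exact ⟨v, hG, hd, fun a b => hdiam ▸ SimpleGraph.dist_le_diam (ediam_ne_top_of_connected hG), hv⟩

/-! ### The extremal graphs -/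

section PathWithClique

variable {n d k : ℕ}

/-- A potential that changes at most by one along an edge if `k` is `2` or `3`, so that it bounds
distances from below: the path vertex `v_i` has position `i`, and all clique vertices have
position `k - 2`. -/
def position (n d k : ℕ) : Fin (d + 1) ⊕ Fin (n - d - 1) → ℤ :=
  Sum.elim (fun i => (i : ℕ)) (fun _ => (k : ℤ) - 2)

lemma position_le_add_one_of_adj (hk2 : 2 ≤ k) (hk : k ≤ 3) {x y : Fin (d + 1) ⊕ Fin (n - d - 1)}
    (h : (pathWithClique n d k).Adj x y) : position n d k x ≤ position n d k y + 1 := by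
  rcases x with i | a <;> rcases y with j | b <;>
    simp only [pathWithClique, position, Sum.elim_inl, Sum.elim_inr] at h ⊢ <;> omega

lemma position_le_add_length (hk2 : 2 ≤ k) (hk : k ≤ 3) {x y : Fin (d + 1) ⊕ Fin (n - d - 1)}
    (p : (pathWithClique n d k).Walk x y) :
    position n d k x ≤ position n d k y + p.length := by
  induction p with
  | nil => simp
  | cons h p ih =>
    have := position_le_add_one_of_adj hk2 hk h
    rw [SimpleGraph.Walk.length_cons]
    push_cast
    linarith

lemma exists_walk_inl_inl (i j : ℕ) (hij : i ≤ j) (hj : j < d + 1) :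
    ∃ p : (pathWithClique n d k).Walk (Sum.inl ⟨i, by omega⟩) (Sum.inl ⟨j, hj⟩),
      p.length = j - i := by
  induction j, hij using Nat.le_induction with
  | base => exact ⟨SimpleGraph.Walk.nil, by simp⟩
  | succ j hij ih =>
    obtain ⟨p, hp⟩ := ih (by omega)
    have hadj : (pathWithClique n d k).Adj (Sum.inl ⟨j, by omega⟩) (Sum.inl ⟨j + 1, hj⟩) :=
      Or.inl rfl
    refine ⟨p.concat hadj, ?_⟩
    rw [SimpleGraph.Walk.length_concat, hp]
    omega

lemma exists_walk_inr_inl (hk2 : 2 ≤ k) (hd : 3 ≤ d) (a : Fin (n - d - 1)) (j : Fin (d + 1)) :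
    ∃ p : (pathWithClique n d k).Walk (Sum.inr a) (Sum.inl j), p.length ≤ d := by
  obtain ⟨j, hj⟩ := j
  rcases Nat.eq_zero_or_pos j with rfl | hj0
  · have hadj : (pathWithClique n d k).Adj (Sum.inr a) (Sum.inl ⟨0, hj⟩) := by
      change 0 < k
      omega
    exact ⟨.cons hadj .nil, by
        rw [SimpleGraph.Walk.length_cons, SimpleGraph.Walk.length_nil]; omega⟩
  · have hadj : (pathWithClique n d k).Adj (Sum.inr a) (Sum.inl ⟨1, by omega⟩) := by
      change 1 < k
      omega
    obtain ⟨p, hp⟩ := exists_walk_inl_inl (n := n) (d := d) (k := k) 1 j hj0 hj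
    exact ⟨SimpleGraph.Walk.cons hadj p, by rw [SimpleGraph.Walk.length_cons]; omega⟩

lemma exists_walk_length_le (hk2 : 2 ≤ k) (hd : 3 ≤ d) (x y : Fin (d + 1) ⊕ Fin (n - d - 1)) :
    ∃ p : (pathWithClique n d k).Walk x y, p.length ≤ d := by
  rcases x with i | a <;> rcases y with j | b
  · rcases le_total (i : ℕ) j with hij | hij
    · obtain ⟨p, hp⟩ := exists_walk_inl_inl (n := n) (k := k) (i : ℕ) j hij j.2
      exact ⟨p, by omega⟩
    · obtain ⟨p, hp⟩ := exists_walk_inl_inl (n := n) (k := k) (j : ℕ) i hij i.2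
      exact ⟨p.reverse, by rw [SimpleGraph.Walk.length_reverse]; omega⟩
  · obtain ⟨p, hp⟩ := exists_walk_inr_inl hk2 hd b i
    exact ⟨p.reverse, by rwa [SimpleGraph.Walk.length_reverse]⟩
  · exact exists_walk_inr_inl hk2 hd a j
  · by_cases hab : a = b
    · subst hab
      exact ⟨SimpleGraph.Walk.nil, by simp⟩
    · have hadj : (pathWithClique n d k).Adj (Sum.inr a) (Sum.inr b) := hab
      exact ⟨.cons hadj .nil, by
        rw [SimpleGraph.Walk.length_cons, SimpleGraph.Walk.length_nil]; omega⟩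

lemma connected_pathWithClique (hk2 : 2 ≤ k) (hd : 3 ≤ d) : (pathWithClique n d k).Connected where
  preconnected x y := ⟨(exists_walk_length_le hk2 hd x y).choose⟩
  nonempty := ⟨Sum.inl 0⟩

lemma position_le_add_dist (hk2 : 2 ≤ k) (hk : k ≤ 3) (hd : 3 ≤ d)
    (x y : Fin (d + 1) ⊕ Fin (n - d - 1)) :
    position n d k x ≤ position n d k y + (pathWithClique n d k).dist x y := by
  obtain ⟨p, hp⟩ := (connected_pathWithClique (n := n) hk2 hd).exists_walk_length_eq_dist x y
  rw [← hp]
  exact position_le_add_length hk2 hk p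

lemma diam_pathWithClique (hk2 : 2 ≤ k) (hk : k ≤ 3) (hd : 3 ≤ d) :
    (pathWithClique n d k).diam = d := by
  have hconn := connected_pathWithClique (n := n) hk2 hd
  refine le_antisymm ?_ ?_
  · have := hconn.nonempty
    obtain ⟨x, y, hxy⟩ := SimpleGraph.exists_dist_eq_diam (G := pathWithClique n d k)
    obtain ⟨p, hp⟩ := exists_walk_length_le (n := n) hk2 hd x y
    exact hxy ▸ (SimpleGraph.dist_le p).trans hp
  · have h1 := position_le_add_dist (n := n) hk2 hk hd (Sum.inl (Fin.last d)) (Sum.inl 0)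
    have h2 := SimpleGraph.dist_le_diam (ediam_ne_top_of_connected hconn)
      (u := Sum.inl (Fin.last d)) (v := Sum.inl 0)
    simp only [position, Sum.elim_inl, Fin.val_last, Fin.val_zero] at h1
    omega

lemma max_le_eccentricity_inl (hk2 : 2 ≤ k) (hk : k ≤ 3) (hd : 3 ≤ d) (i : Fin (d + 1)) :
    max (i : ℕ) (d - i) ≤ eccentricity (pathWithClique n d k) (Sum.inl i) := by
  have hconn := connected_pathWithClique (n := n) hk2 hd
  have h1 := position_le_add_dist (n := n) hk2 hk hd (Sum.inl i) (Sum.inl 0)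
  have h2 := position_le_add_dist (n := n) hk2 hk hd (Sum.inl (Fin.last d)) (Sum.inl i)
  have h3 := dist_le_eccentricity hconn (Sum.inl i) (Sum.inl 0)
  have h4 := dist_le_eccentricity hconn (Sum.inl i) (Sum.inl (Fin.last d))
  rw [SimpleGraph.dist_comm] at h4
  simp only [position, Sum.elim_inl, Fin.val_last, Fin.val_zero] at h1 h2
  omega

lemma le_eccentricity_inr (hk2 : 2 ≤ k) (hk : k ≤ 3) (hd : 3 ≤ d) (a : Fin (n - d - 1)) :
    d + 2 - k ≤ eccentricity (pathWithClique n d k) (Sum.inr a) := by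
  have hconn := connected_pathWithClique (n := n) hk2 hd
  have h1 := position_le_add_dist (n := n) hk2 hk hd (Sum.inl (Fin.last d)) (Sum.inr a)
  have h2 := dist_le_eccentricity hconn (Sum.inr a) (Sum.inl (Fin.last d))
  rw [SimpleGraph.dist_comm] at h2
  simp only [position, Sum.elim_inl, Sum.elim_inr, Fin.val_last] at h1
  omega

lemma le_two_mul_sigmaTwo_pathWithClique {m : ℕ} (hm : n - d - 1 = m) (hk2 : 2 ≤ k) (hk : k ≤ 3)
    (hd : 3 ≤ d) :
    2 * minPathWeight d + 2 * (m * ((d + 2 - k) * ∑ i ∈ Finset.range k, (d - i))) +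
      m * (m - 1) * (d + 2 - k) ^ 2 ≤ 2 * sigmaTwo (pathWithClique n d k) := by
  classical
  subst hm
  set G := pathWithClique n d k with hG
  set e := d + 2 - k with he
  have hinl : ∀ i : Fin (d + 1), max (i : ℕ) (d - i) ≤ eccentricity G (Sum.inl i) :=
    fun i => max_le_eccentricity_inl hk2 hk hd i
  have hinr : ∀ a, e ≤ eccentricity G (Sum.inr a) := fun a => le_eccentricity_inr hk2 hk hd a
  have hpath : 2 * minPathWeight d ≤
      ∑ i : Fin (d + 1), ∑ j : Fin (d + 1), pairWeight G (Sum.inl i) (Sum.inl j) := by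
    rw [minPathWeight, ← sum_range_consecutive (fun i => max i (d - i)), Finset.sum_range]
    refine Finset.sum_le_sum fun i _ => ?_
    rw [Finset.sum_range]
    refine Finset.sum_le_sum fun j _ => ?_
    have hij : G.Adj (Sum.inl i) (Sum.inl j) ↔ (i : ℕ) + 1 = j ∨ (j : ℕ) + 1 = i := Iff.rfl
    rw [pairWeight]
    split_ifs with h1 h2 h2
    · exact Nat.mul_le_mul (hinl i) (hinl j)
    · exact absurd (hij.2 h1) h2
    · exact Nat.zero_le _
    · exact le_rfl
  have hcross : ∀ a, e * ∑ i ∈ Finset.range k, (d - i) ≤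
      ∑ j : Fin (d + 1), pairWeight G (Sum.inr a) (Sum.inl j) := by
    intro a
    calc e * ∑ i ∈ Finset.range k, (d - i)
        = ∑ j ∈ Finset.range k, if j < k then e * (d - j) else 0 := by
          rw [Finset.mul_sum]
          exact Finset.sum_congr rfl fun j hj => by rw [if_pos (Finset.mem_range.1 hj)]
      _ ≤ ∑ j ∈ Finset.range (d + 1), if j < k then e * (d - j) else 0 :=
          Finset.sum_le_sum_of_subset (Finset.range_subset_range.2 (by omega))
      _ = ∑ j : Fin (d + 1), if (j : ℕ) < k then e * (d - j) else 0 := Finset.sum_range _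
      _ ≤ _ := Finset.sum_le_sum fun j _ => by
          have hj : G.Adj (Sum.inr a) (Sum.inl j) ↔ (j : ℕ) < k := Iff.rfl
          rw [pairWeight]
          split_ifs with h1 h2 h2
          · exact Nat.mul_le_mul (hinr a) ((le_max_right _ _).trans (hinl j))
          · exact absurd (hj.2 h1) h2
          · exact Nat.zero_le _
          · exact le_rfl
  have hclique : ∀ a, (n - d - 1 - 1) * e ^ 2 ≤ ∑ b, pairWeight G (Sum.inr a) (Sum.inr b) := by
    intro a
    calc (n - d - 1 - 1) * e ^ 2 = ∑ _b ∈ Finset.univ.erase a, e ^ 2 := by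
          rw [Finset.sum_const, Finset.card_erase_of_mem (Finset.mem_univ a), Finset.card_univ,
            Fintype.card_fin, smul_eq_mul]
      _ ≤ ∑ b ∈ Finset.univ.erase a, pairWeight G (Sum.inr a) (Sum.inr b) :=
          Finset.sum_le_sum fun b hb => by
            have hab : G.Adj (Sum.inr a) (Sum.inr b) := (Finset.ne_of_mem_erase hb).symm
            rw [pairWeight, if_pos hab, pow_two]
            exact Nat.mul_le_mul (hinr a) (hinr b)
      _ ≤ _ := Finset.sum_le_sum_of_subset (Finset.subset_univ _)
  have hcross' := Finset.sum_le_sum fun a (_ : a ∈ Finset.univ) => hcross a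
  have hclique' := Finset.sum_le_sum fun a (_ : a ∈ Finset.univ) => hclique a
  have hswap : ∑ i : Fin (d + 1), ∑ a, pairWeight G (Sum.inl i) (Sum.inr a) =
      ∑ a, ∑ i : Fin (d + 1), pairWeight G (Sum.inr a) (Sum.inl i) := by
    rw [Finset.sum_comm]
    exact Finset.sum_congr rfl fun a _ => Finset.sum_congr rfl fun i _ => pairWeight_comm _ _ _
  rw [Finset.sum_const, Finset.card_univ, Fintype.card_fin, smul_eq_mul] at hcross' hclique'
  rw [two_mul_sigmaTwo, Fintype.sum_sum_type]
  simp only [Fintype.sum_sum_type, Finset.sum_add_distrib]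
  rw [hswap]
  rw [← mul_assoc] at hclique'
  linarith

end PathWithClique

theorem theorem2p15 (n d : ℕ) (hd : 3 ≤ d) (hn : d < n) :
    ((d : ℚ) ≤ ((n : ℚ) + 2) / 2 → MaximizesSigmaTwo.{u} n d (graphB n d)) ∧
    (((n : ℚ) + 3) / 2 ≤ (d : ℚ) → MaximizesSigmaTwo.{u} n d (graphB' n d)) := by
  have hcard : Fintype.card (Fin (d + 1) ⊕ Fin (n - d - 1)) = n := by
    rw [Fintype.card_sum, Fintype.card_fin, Fintype.card_fin]
    omega
  obtain ⟨m, rfl⟩ : ∃ m, n = d + 1 + m := ⟨n - d - 1, by omega⟩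
  have hm : d + 1 + m - d - 1 = m := by omega
  have hmm : m * (m - 1) + m = m ^ 2 := by
    rcases m with _ | m
    · rfl
    · rw [Nat.add_sub_cancel]; ring
  refine ⟨fun hdn => ⟨⟨hcard, connected_pathWithClique le_rfl hd,
    diam_pathWithClique le_rfl (by norm_num) hd⟩, fun V _ G hV hG hdiam => ?_⟩,
    fun hdn => ⟨⟨hcard, connected_pathWithClique (by norm_num) hd,
    diam_pathWithClique (by norm_num) le_rfl hd⟩, fun V _ G hV hG hdiam => ?_⟩⟩
  · have hdm : d ≤ m + 3 := by
      rw [le_div_iff₀ (by norm_num)] at hdn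
      have : d * 2 ≤ d + 1 + m + 2 := by exact_mod_cast hdn
      omega
    obtain ⟨v, hv⟩ := exists_isDiametralPath hG hd hdiam
    have hW := hv.isGeodesic.card_offPath
    obtain hW : (offPath d v).card = m := by omega
    have hup := hv.two_mul_sigmaTwo_le_of_le (by omega)
    have hlow := le_two_mul_sigmaTwo_pathWithClique (k := 2) hm le_rfl
      (by norm_num) hd
    rw [hW] at hup
    change sigmaTwo G ≤ sigmaTwo (pathWithClique (d + 1 + m) d 2)
    generalize sigmaTwo (pathWithClique (d + 1 + m) d 2) = B at hlow ⊢
    rw [Nat.add_sub_cancel, Finset.sum_range_succ, Finset.sum_range_one] at hlow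
    obtain ⟨c, rfl⟩ : ∃ c, d = c + 1 := ⟨d - 1, by omega⟩
    rw [Nat.sub_zero, Nat.add_sub_cancel] at hlow
    have := congrArg (fun x => x * (c + 1) ^ 2) hmm
    nlinarith
  · have hdm : m + 4 ≤ d := by
      rw [div_le_iff₀ (by norm_num)] at hdn
      have : d + 1 + m + 3 ≤ d * 2 := by exact_mod_cast hdn
      omega
    obtain ⟨v, hv⟩ := exists_isDiametralPath hG hd hdiam
    have hW := hv.isGeodesic.card_offPath
    obtain hW : (offPath d v).card = m := by omega
    have hup := hv.two_mul_sigmaTwo_le_of_add_four_le (by omega)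
    have hlow := le_two_mul_sigmaTwo_pathWithClique (k := 3) hm (by norm_num)
      le_rfl hd
    rw [hW] at hup
    change sigmaTwo G ≤ sigmaTwo (pathWithClique (d + 1 + m) d 3)
    generalize sigmaTwo (pathWithClique (d + 1 + m) d 3) = B at hlow ⊢
    rw [Finset.sum_range_succ, Finset.sum_range_succ, Finset.sum_range_one] at hlow
    obtain ⟨c, rfl⟩ : ∃ c, d = c + 2 := ⟨d - 2, by omega⟩
    rw [show c + 2 + 2 - 3 = c + 1 by omega, show c + 2 - 1 = c + 1 by omega,
      Nat.add_sub_cancel, Nat.sub_zero] at hlow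
    rw [show c + 2 - 1 = c + 1 by omega] at hup
    have := congrArg (fun x => x * (c + 1) ^ 2) hmm
    nlinarith
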